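/- Consider the two-player differential game on $[0,T]$ ($T\ge 0$) with dynamics $\dot x=f(t,x,u)+g(t,x,v)$, $x\in\mathbb R^n$, $u\in P$, $v\in Q$, in which player I maximizes $\sigma_1(x(T))$ and player II maximizes $\sigma_2(x(T))$. Here $P,Q$ are nonempty compact metric spaces, $f,g$ are continuous on $[0,T]\times\mathbb R^n\times P$ and $[0,T]\times\mathbb R^n\times Q$, Lipschitz in $x$ on bounded sets uniformly in the other variables, and of sublinear growth ($\|f(t,x,u)\|\le C(1+\|x\|)$ and $\|g(t,x,v)\|\le C(1+\|x\|)$ for some constant $C$), and $\sigma_1,\sigma_2:\mathbb R^n\to\mathbb R$ are continuous. Let $\mathcal U$, $\mathcal V$ be the sets of measurable functions $[0,T]\to P$, $[0,T]\to Q$, and let $x(\cdot,t_0,x_0,u,v)$ be the solution on $[0,T]$ with $x(t_0)=x_0$ under the controls $u\in\mathcal U$, $v\in\mathcal V$. With closures in $C([0,T];\mathbb R^n)$, put, for constants $u_*\in P$, $v_*\in Q$, $$\mathrm{Sol}^1(t,x;v_*)=\mathrm{cl}\{x(\cdot,t,x,u,v_*):u\in\mathcal U\},\quad \mathrm{Sol}^2(t,x;u_*)=\mathrm{cl}\{x(\cdot,t,x,u_*,v):v\in\mathcal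 V\},$$ $$\mathrm{Sol}(t,x)=\mathrm{cl}\{x(\cdot,t,x,u,v):u\in\mathcal U,\,v\in\mathcal V\}.$$ A control with guide strategy of player I is a triple $U=(u,\psi,\chi)$ of arbitrary functions $u:[0,T]\times\mathbb R^n\times\mathbb R^m\to P$, $\psi:[0,T]\times[0,T]\times\mathbb R^n\times\mathbb R^m\to\mathbb R^m$, $\chi:[0,T]\times\mathbb R^n\to\mathbb R^m$, for some natural number $m$; a strategy $V$ of player II is defined in the same way, with $Q$ in place of $P$ (and its own $m$). Given an initial position $(t_0,x_0)$ and a partition $\Delta=\{t_0<t_1<\dots<t_r=T\}$ of $[t_0,T]$ with mesh $d(\Delta)=\max_k(t_{k+1}-t_k)$, a player who uses such a strategy applies on each $[t_k,t_{k+1})$ the constant control $u(t_k,x_k,w_k)$, where $x_k$ is the state of the system at time $t_k$, $w_0=\chi(t_0,x_0)$ and $w_{k+1}=\psi(t_{k+1},t_k,x_k,w_k)$. Let $x^1[\cdot,t_0,x_0,U,\Delta,v]$ be the motion on $[t_0,T]$ from $(t_0,x_0)$ when player I uses $U$ with $\Delta$ and player II uses $v\in\mathcal V$; $x^2[\cdot,t_0,x_0,V,\Delta,u]$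 the motion when player II uses $V$ with $\Delta$ and player I uses $u\in\mathcal U$; and $x^{(c)}[\cdot,t_0,x_0,U,V,\Delta]$ the motion when both use their strategies with the same $\Delta$. The payoff of player $i$ under $(U,V)$ at $(t_0,x_0)$ is $$J_i^{U,V}(t_0,x_0)=\lim_{\delta\downarrow0}\inf\{\sigma_i(x^{(c)}[T,t_0,x_0,U,V,\Delta]):d(\Delta)\le\delta\}.$$ The pair $(U,V)$ is a control with guide Nash equilibrium on $G\subset[0,T]\times\mathbb R^n$ if for all $(t_0,x_0)\in G$ $$\lim_{\delta\downarrow0}\sup\{\sigma_1(x^2[T,t_0,x_0,V,\Delta,u]):d(\Delta)\le\delta,\,u\in\mathcal U\}\le J_1^{U,V}(t_0,x_0),$$ $$\lim_{\delta\downarrow0}\sup\{\sigma_2(x^1[T,t_0,x_0,U,\Delta,v]):d(\Delta)\le\delta,\,v\in\mathcal V\}\le J_2^{U,V}(t_0,x_0).$$ **Theorem.** Let $S:[0,T]\times\mathbb R^n\rightrightarrows\mathbb R^2$ be an upper semicontinuous multifunction (for every $(t,x)$ and every open $O\supset S(t,x)$ one has $S(t',x')\subset O$ for all $(t',x')$ near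 $(t,x)$) with nonempty values such that - (S1) $S(T,x)=\{(\sigma_1(x),\sigma_2(x))\}$ for all $x\in\mathbb R^n$; - (S2) for all $(t,x)\in[0,T]\times\mathbb R^n$, $(J_1,J_2)\in S(t,x)$, $u\in P$ and $t_+\in[t,T]$ there are $y\in\mathrm{Sol}^2(t,x;u)$ and $(J_1',J_2')\in S(t_+,y(t_+))$ with $J_1\ge J_1'$; - (S3) for all $(t,x)\in[0,T]\times\mathbb R^n$, $(J_1,J_2)\in S(t,x)$, $v\in Q$ and $t_+\in[t,T]$ there are $y\in\mathrm{Sol}^1(t,x;v)$ and $(J_1'',J_2'')\in S(t_+,y(t_+))$ with $J_2\ge J_2''$; - (S4) for all $(t,x)\in[0,T]\times\mathbb R^n$, $(J_1,J_2)\in S(t,x)$ and $t_+\in[t,T]$ there is $y\in\mathrm{Sol}(t,x)$ with $(J_1,J_2)\in S(t_+,y(t_+))$. Then for every selector $(\hat J_1,\hat J_2)$ of $S$ and every compact $G\subset[0,T]\times\mathbb R^n$ there is a pair $(U,V)$ of control with guide strategies that is a control with guide Nash equilibrium on $G$ and satisfies $J_i^{U,V}(t_0,x_0)=\hat J_i(t_0,x_0)$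 for $i=1,2$ and all $(t_0,x_0)\in G$. -/

import Mathlib

open Set Filter Topology MeasureTheory

/-- `n`-dimensional Euclidean space. -/
abbrev Euc (n : ℕ) : Type := EuclideanSpace ℝ (Fin n)

/-- The time interval `[0,T]` as a type; `TimeInt T × Euc n` is the space of positions
`[0,T] × ℝⁿ`. -/
abbrev TimeInt (T : ℝ) : Type := Set.Icc (0 : ℝ) T

/-- The data of the two-player game: horizon `T`, dynamics `ẋ = f(t,x,u) + g(t,x,v)` on `[0,T]`,
terminal payoffs `σ₁(x(T))`, `σ₂(x(T))`. Player I chooses `u ∈ P`, player II chooses `v ∈ Q`,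
and both players maximize. Values of `f`, `g` at times outside `[0,T]` play no role. -/
structure DiffGame (n : ℕ) (P Q : Type*) where
  T : ℝ
  f : ℝ → Euc n → P → Euc n
  g : ℝ → Euc n → Q → Euc n
  σ₁ : Euc n → ℝ
  σ₂ : Euc n → ℝ

/-- Conditions on one control term `h : [0,T] × ℝⁿ × A → ℝⁿ` of the dynamics: it is continuous,
Lipschitz in the phase variable on bounded sets (uniformly in time and control), and of sublinear
growth in the phase variable. -/
structure AdmissibleDynamics {n : ℕ} {A : Type*} [TopologicalSpace A] (T : ℝ)
    (h : ℝ → Euc n → A → Euc n) : Prop where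
  cont : ContinuousOn (fun p : ℝ × Euc n × A => h p.1 p.2.1 p.2.2) (Icc 0 T ×ˢ univ)
  lipschitz : ∀ R : ℝ, ∃ L : ℝ, ∀ t ∈ Icc 0 T, ∀ x y : Euc n, ‖x‖ ≤ R → ‖y‖ ≤ R →
    ∀ a : A, ‖h t x a - h t y a‖ ≤ L * ‖x - y‖
  growth : ∃ C : ℝ, ∀ t ∈ Icc 0 T, ∀ (x : Euc n) (a : A), ‖h t x a‖ ≤ C * (1 + ‖x‖)

/-- (Lebesgue) measurable controls `[0,T] → A`. Values outside `[0,T]` play no role. -/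
def IsControl {A : Type*} [MeasurableSpace A] (T : ℝ) (u : ℝ → A) : Prop :=
  AEMeasurable u (volume.restrict (Icc 0 T))

/-- A control with guide strategy: the dimension `m` of the guide, the function `(t, x, w) ↦ A`
forming the control, the transition `(t₊, t, x, w) ↦ w₊` of the guide, and the initial state
`(t₀, x₀) ↦ w₀` of the guide. No regularity is required. -/
structure GuideStrategy (T : ℝ) (n : ℕ) (A : Type*) where
  m : ℕ
  control : TimeInt T → Euc n → Euc m → A
  trans : TimeInt T → TimeInt T → Euc n → Euc m → Euc m
  init : TimeInt T → Euc n → Euc m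

/-- A partition `t₀ < t₁ < ⋯ < t_r = T` of `[t₀,T]` (if `t₀ = T` then `r = 0`).
Values `pts k` with `k > r` play no role. -/
structure TimePartition (T : ℝ) (t₀ : TimeInt T) where
  r : ℕ
  pts : ℕ → TimeInt T
  first : pts 0 = t₀
  last : (pts r : ℝ) = T
  increasing : ∀ k < r, pts k < pts (k + 1)

/-- `d(Δ) ≤ δ`, where `d(Δ) = max_k (t_{k+1} - t_k)`. -/
def TimePartition.MeshLE {T : ℝ} {t₀ : TimeInt T} (Δ : TimePartition T t₀) (δ : ℝ) : Prop :=
  ∀ k < Δ.r, (Δ.pts (k + 1) : ℝ) - (Δ.pts k : ℝ) ≤ δ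

/-- The state `w_k` of the guide at time `t_k` along a motion `x`: `w₀ = χ(t₀,x₀)` and
`w_{k+1} = ψ(t_{k+1}, t_k, x(t_k), w_k)`. -/
def GuideStrategy.guide {T : ℝ} {n : ℕ} {A : Type*} (U : GuideStrategy T n A) {t₀ : TimeInt T}
    (Δ : TimePartition T t₀) (x₀ : Euc n) (x : ℝ → Euc n) : ℕ → Euc U.m
  | 0 => U.init t₀ x₀
  | k + 1 => U.trans (Δ.pts (k + 1)) (Δ.pts k) (x (Δ.pts k)) (U.guide Δ x₀ x k)

/-- On each `[t_k, t_{k+1})` the control `u` is constantly the one that the strategy `U` forms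
from the position `(t_k, x(t_k))` and the guide `w_k`. -/
def GuideStrategy.Generates {T : ℝ} {n : ℕ} {A : Type*} (U : GuideStrategy T n A) {t₀ : TimeInt T}
    (Δ : TimePartition T t₀) (x₀ : Euc n) (x : ℝ → Euc n) (u : ℝ → A) : Prop :=
  ∀ k < Δ.r, ∀ s ∈ Ico (Δ.pts k : ℝ) (Δ.pts (k + 1) : ℝ),
    u s = U.control (Δ.pts k) (x (Δ.pts k)) (U.guide Δ x₀ x k)

namespace DiffGame

variable {n : ℕ} {P Q : Type*} (Γ : DiffGame n P Q)

/-- `x` is on `[a,b]` the (Carathéodory) solution of `ẋ = f(t,x,u(t)) + g(t,x,v(t))`,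
`x(t₀) = x₀`. -/
def IsSolution (a b t₀ : ℝ) (x₀ : Euc n) (u : ℝ → P) (v : ℝ → Q) (x : ℝ → Euc n) : Prop :=
  ContinuousOn x (Icc a b) ∧
  IntegrableOn (fun s => Γ.f s (x s) (u s) + Γ.g s (x s) (v s)) (Icc a b) ∧
  ∀ t ∈ Icc a b, x t = x₀ + ∫ s in t₀..t, (Γ.f s (x s) (u s) + Γ.g s (x s) (v s))

/-- The continuous function `y` on `[0,T]` is the solution `x(·,t₀,x₀,u,v)`. -/
def IsMotion (t₀ : TimeInt Γ.T) (x₀ : Euc n) (u : ℝ → P) (v : ℝ → Q)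
    (y : C(TimeInt Γ.T, Euc n)) : Prop :=
  ∃ x : ℝ → Euc n, Γ.IsSolution 0 Γ.T t₀ x₀ u v x ∧ ∀ s : TimeInt Γ.T, y s = x s

/-- `Sol¹(t,x;v) = cl {x(·,t,x,u,v) : u ∈ 𝒰}`, for a constant control `v` of player II;
the closure is with respect to uniform convergence on `[0,T]`. -/
def Sol₁ [MeasurableSpace P] (t : TimeInt Γ.T) (x : Euc n) (v : Q) : Set C(TimeInt Γ.T, Euc n) :=
  closure {y | ∃ u : ℝ → P, IsControl Γ.T u ∧ Γ.IsMotion t x u (fun _ => v) y}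

/-- `Sol²(t,x;u) = cl {x(·,t,x,u,v) : v ∈ 𝒱}`, for a constant control `u` of player I. -/
def Sol₂ [MeasurableSpace Q] (t : TimeInt Γ.T) (x : Euc n) (u : P) : Set C(TimeInt Γ.T, Euc n) :=
  closure {y | ∃ v : ℝ → Q, IsControl Γ.T v ∧ Γ.IsMotion t x (fun _ => u) v y}

/-- `Sol(t,x) = cl {x(·,t,x,u,v) : u ∈ 𝒰, v ∈ 𝒱}`. -/
def Sol [MeasurableSpace P] [MeasurableSpace Q] (t : TimeInt Γ.T) (x : Euc n) :
    Set C(TimeInt Γ.T, Euc n) :=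
  closure {y | ∃ (u : ℝ → P) (v : ℝ → Q), IsControl Γ.T u ∧ IsControl Γ.T v ∧ Γ.IsMotion t x u v y}

/-- `x = x¹[·,t₀,x₀,U,Δ,v]` on `[t₀,T]`: player I uses the strategy `U` with the partition `Δ`,
player II uses the control `v`. -/
def IsStepMotion₁ [MeasurableSpace P] (t₀ : TimeInt Γ.T) (x₀ : Euc n) (U : GuideStrategy Γ.T n P)
    (Δ : TimePartition Γ.T t₀) (v : ℝ → Q) (x : ℝ → Euc n) : Prop :=
  ∃ u : ℝ → P, IsControl Γ.T u ∧ U.Generates Δ x₀ x u ∧ Γ.IsSolution t₀ Γ.T t₀ x₀ u v x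

/-- `x = x²[·,t₀,x₀,V,Δ,u]` on `[t₀,T]`: player II uses the strategy `V` with the partition `Δ`,
player I uses the control `u`. -/
def IsStepMotion₂ [MeasurableSpace Q] (t₀ : TimeInt Γ.T) (x₀ : Euc n) (V : GuideStrategy Γ.T n Q)
    (Δ : TimePartition Γ.T t₀) (u : ℝ → P) (x : ℝ → Euc n) : Prop :=
  ∃ v : ℝ → Q, IsControl Γ.T v ∧ V.Generates Δ x₀ x v ∧ Γ.IsSolution t₀ Γ.T t₀ x₀ u v x

variable [MeasurableSpace P] [MeasurableSpace Q]

/-- `x = x⁽ᶜ⁾[·,t₀,x₀,U,V,Δ]` on `[t₀,T]`: both players use their strategies with the same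
partition `Δ`. -/
def IsStepMotionC (t₀ : TimeInt Γ.T) (x₀ : Euc n) (U : GuideStrategy Γ.T n P)
    (V : GuideStrategy Γ.T n Q) (Δ : TimePartition Γ.T t₀) (x : ℝ → Euc n) : Prop :=
  ∃ (u : ℝ → P) (v : ℝ → Q), IsControl Γ.T u ∧ IsControl Γ.T v ∧
    U.Generates Δ x₀ x u ∧ V.Generates Δ x₀ x v ∧ Γ.IsSolution t₀ Γ.T t₀ x₀ u v x

/-- `sup {σ₂(x¹[T,t₀,x₀,U,Δ,v]) : d(Δ) ≤ δ, v ∈ 𝒱}`. -/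
noncomputable def devSup₂ (U : GuideStrategy Γ.T n P) (t₀ : TimeInt Γ.T) (x₀ : Euc n) (δ : ℝ) :
    EReal :=
  sSup {c | ∃ (Δ : TimePartition Γ.T t₀) (v : ℝ → Q) (x : ℝ → Euc n), Δ.MeshLE δ ∧
    IsControl Γ.T v ∧ Γ.IsStepMotion₁ t₀ x₀ U Δ v x ∧ c = ((Γ.σ₂ (x Γ.T) : ℝ) : EReal)}

/-- `sup {σ₁(x²[T,t₀,x₀,V,Δ,u]) : d(Δ) ≤ δ, u ∈ 𝒰}`. -/
noncomputable def devSup₁ (V : GuideStrategy Γ.T n Q) (t₀ : TimeInt Γ.T) (x₀ : Euc n) (δ : ℝ) :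
    EReal :=
  sSup {c | ∃ (Δ : TimePartition Γ.T t₀) (u : ℝ → P) (x : ℝ → Euc n), Δ.MeshLE δ ∧
    IsControl Γ.T u ∧ Γ.IsStepMotion₂ t₀ x₀ V Δ u x ∧ c = ((Γ.σ₁ (x Γ.T) : ℝ) : EReal)}

/-- `inf {σ(x⁽ᶜ⁾[T,t₀,x₀,U,V,Δ]) : d(Δ) ≤ δ}`, for a terminal payoff `σ`. -/
noncomputable def jointInf (σ : Euc n → ℝ) (U : GuideStrategy Γ.T n P) (V : GuideStrategy Γ.T n Q)
    (t₀ : TimeInt Γ.T) (x₀ : Euc n) (δ : ℝ) : EReal :=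
  sInf {c | ∃ (Δ : TimePartition Γ.T t₀) (x : ℝ → Euc n), Δ.MeshLE δ ∧
    Γ.IsStepMotionC t₀ x₀ U V Δ x ∧ c = ((σ (x Γ.T) : ℝ) : EReal)}

/-- `(U,V)` is a Control with Guide Nash equilibrium on `G`: at every `(t₀,x₀) ∈ G`, for each
player `i`, the limit as `δ ↓ 0` of the supremum of the payoffs that player `i` can reach by an
arbitrary control against the other player's strategy is at most the limit of `jointInf`. -/
def IsNash (U : GuideStrategy Γ.T n P) (V : GuideStrategy Γ.T n Q)
    (G : Set (TimeInt Γ.T × Euc n)) : Prop :=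
  ∀ p ∈ G,
    (∃ a b : EReal, Tendsto (Γ.devSup₁ V p.1 p.2) (𝓝[>] 0) (𝓝 a) ∧
      Tendsto (Γ.jointInf Γ.σ₁ U V p.1 p.2) (𝓝[>] 0) (𝓝 b) ∧ a ≤ b) ∧
    (∃ a b : EReal, Tendsto (Γ.devSup₂ U p.1 p.2) (𝓝[>] 0) (𝓝 a) ∧
      Tendsto (Γ.jointInf Γ.σ₂ U V p.1 p.2) (𝓝[>] 0) (𝓝 b) ∧ a ≤ b)

/-- The payoffs of the pair `(U,V)` at the position `p` are `J = (J₁,J₂)`. -/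
def HasPayoff (U : GuideStrategy Γ.T n P) (V : GuideStrategy Γ.T n Q)
    (p : TimeInt Γ.T × Euc n) (J : ℝ × ℝ) : Prop :=
  Tendsto (Γ.jointInf Γ.σ₁ U V p.1 p.2) (𝓝[>] 0) (𝓝 (J.1 : EReal)) ∧
  Tendsto (Γ.jointInf Γ.σ₂ U V p.1 p.2) (𝓝[>] 0) (𝓝 (J.2 : EReal))

end DiffGame

/-! The equilibrium is of trigger type. Each player carries a model motion (the guide) and a
promised payoff pair lying in `S` at the model position. As long as the states at the nodes are ones
that the prescribed controls can produce, (S4) moves the model and keeps the promised pair. After a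
discrepancy, the other player moves the model by (S3), or by (S2) in the case of player II, so that
the promised payoff of the deviator cannot increase. At time `T`, (S1) identifies the promised pair
with the terminal payoffs of the model position. By continuity of the payoffs it remains to keep the
state near the model.

This is done by extremal shift. Let `s` be the state minus the model position. Each prescribed
control minimizes the component along `s` of its own term of the dynamics; since the dynamics is `f
+ g`, the two terms are treated separately. In regular play both terms are minimized, so any model
controls will do. In punishment the model applies for the deviator the constant control maximizing
its component along `s`, which dominates whatever the deviator really does. In both cases
`exists_shift_estimate` bounds the growth of the squared distance over a step of length `h` by a
factor `1 + l * h` and a summand `ε * h`.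

The guide at a node is computed from the state at the preceding node, so a deviation is answered one
step late. `Plan.tracking` pays for this step once, with an error of the order of the mesh.
Detection compares states, not controls: if the state could have been reached by the prescribed
constants, the shift estimate is applied to that substitute solution instead.

`Plan.outcome` turns tracking into payoffs. It bounds the gain of a deviator, and, since
`Plan.seq_eq_and_onTrack` excludes false alarms under joint play, it also shows that joint play
yields the selected pair. -/

/-! ### Regularity of the dynamics and a priori bounds -/

/-- A continuous control term is continuous in time and state on bounded sets, uniformly in the
control. -/
lemma AdmissibleDynamics.uniform_continuity {n : ℕ} {A : Type*} [MetricSpace A] [CompactSpace A]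
    {T : ℝ} {h : ℝ → Euc n → A → Euc n} (hh : AdmissibleDynamics T h) (R : ℝ) {η : ℝ}
    (hη : 0 < η) :
    ∃ δ > 0, ∀ t ∈ Icc 0 T, ∀ t' ∈ Icc 0 T, ∀ x x' : Euc n, ‖x‖ ≤ R → ‖x'‖ ≤ R →
      |t - t'| < δ → ‖x - x'‖ < δ → ∀ a : A, ‖h t x a - h t' x' a‖ ≤ η := by
  have hK : IsCompact (Icc 0 T ×ˢ (Metric.closedBall (0 : Euc n) R ×ˢ (univ : Set A))) :=
    isCompact_Icc.prod ((isCompact_closedBall _ _).prod isCompact_univ)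
  have hu := hK.uniformContinuousOn_of_continuous
    (hh.cont.mono (prod_mono_right (subset_univ _)))
  obtain ⟨δ, hδ, H⟩ := Metric.uniformContinuousOn_iff.1 hu η hη
  refine ⟨δ, hδ, fun t ht t' ht' x x' hx hx' htt hxx a => ?_⟩
  have := H (t, x, a) (by simp [ht.1, ht.2, hx]) (t', x', a) (by simp [ht'.1, ht'.2, hx']) (by
    simp only [Prod.dist_eq, dist_self, dist_eq_norm]
    simpa [hδ] using ⟨htt, hxx⟩)
  rw [dist_eq_norm] at this
  exact this.le

namespace DiffGame

variable {n : ℕ} {P Q : Type*} (Γ : DiffGame n P Q)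

/-- The velocity of the system is at most `C (1 + ‖x‖)`. -/
def SpeedBound (C : ℝ) : Prop :=
  0 ≤ C ∧ ∀ t ∈ Icc 0 Γ.T, ∀ x p q, ‖Γ.f t x p + Γ.g t x q‖ ≤ C * (1 + ‖x‖)

variable {Γ}

lemma exists_speedBound [TopologicalSpace P] [TopologicalSpace Q]
    (hf : AdmissibleDynamics Γ.T Γ.f) (hg : AdmissibleDynamics Γ.T Γ.g) :
    ∃ C, Γ.SpeedBound C := by
  obtain ⟨C₁, h₁⟩ := hf.growth
  obtain ⟨C₂, h₂⟩ := hg.growth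
  refine ⟨|C₁| + |C₂|, by positivity, fun t ht x p q => ?_⟩
  have hx : 0 ≤ 1 + ‖x‖ := by positivity
  calc _ ≤ C₁ * (1 + ‖x‖) + C₂ * (1 + ‖x‖) :=
        (norm_add_le _ _).trans (add_le_add (h₁ t ht x p) (h₂ t ht x q))
    _ ≤ |C₁| * (1 + ‖x‖) + |C₂| * (1 + ‖x‖) := by gcongr <;> exact le_abs_self _
    _ = _ := by ring

/-- A solution, restarted from one of its positions and restricted to a smaller interval. -/
lemma IsSolution.restrict {a' b' t₀ a b : ℝ} {x₀ : Euc n} {u : ℝ → P} {v : ℝ → Q}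
    {x : ℝ → Euc n} (h : Γ.IsSolution a' b' t₀ x₀ u v x) (ht₀ : t₀ ∈ Icc a' b') (ha : a' ≤ a)
    (hab : a ≤ b) (hb : b ≤ b') : Γ.IsSolution a b a (x a) u v x := by
  obtain ⟨h₁, h₂, h₃⟩ := h
  have hii : ∀ t ∈ Icc a' b', IntervalIntegrable
      (fun s => Γ.f s (x s) (u s) + Γ.g s (x s) (v s)) volume t₀ t := fun t ht =>
    (h₂.mono_set (uIcc_subset_Icc ht₀ ht)).intervalIntegrable
  refine ⟨h₁.mono (Icc_subset_Icc ha hb), h₂.mono_set (Icc_subset_Icc ha hb), fun t ht => ?_⟩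
  have hta : t ∈ Icc a' b' := ⟨ha.trans ht.1, ht.2.trans hb⟩
  have haa : a ∈ Icc a' b' := ⟨ha, hab.trans hb⟩
  rw [← intervalIntegral.integral_interval_sub_left (hii t hta) (hii a haa), h₃ t hta, h₃ a haa]
  abel

/-- The right endpoint is a null set, so agreement on the half-open interval, where strategies
prescribe controls, is enough. -/
lemma IsSolution.congr_controls {a b t₀ : ℝ} {x₀ : Euc n} {u u' : ℝ → P} {v v' : ℝ → Q}
    {x : ℝ → Euc n} (h : Γ.IsSolution a b t₀ x₀ u v x) (ht₀ : t₀ ∈ Icc a b)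
    (hu : ∀ s ∈ Ico a b, u' s = u s) (hv : ∀ s ∈ Ico a b, v' s = v s) :
    Γ.IsSolution a b t₀ x₀ u' v' x := by
  have hae : (fun s => Γ.f s (x s) (u' s) + Γ.g s (x s) (v' s)) =ᵐ[volume.restrict (Icc a b)]
      fun s => Γ.f s (x s) (u s) + Γ.g s (x s) (v s) := by
    rw [← restrict_Ico_eq_restrict_Icc]
    filter_upwards [ae_restrict_mem measurableSet_Ico] with s hs
    rw [hu s hs, hv s hs]
  refine ⟨h.1, h.2.1.congr hae.symm, fun t ht => ?_⟩
  rw [h.2.2 t ht]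
  congr 1
  refine intervalIntegral.integral_congr_ae ?_
  have := (ae_restrict_iff' measurableSet_Icc).1 hae
  filter_upwards [this] with s hs hst
  exact (hs (uIcc_subset_Icc ht₀ ht (uIoc_subset_uIcc hst))).symm

lemma IsSolution.congr_state {a b t₀ : ℝ} {x₀ : Euc n} {u : ℝ → P} {v : ℝ → Q}
    {x x' : ℝ → Euc n} (h : Γ.IsSolution a b t₀ x₀ u v x) (ht₀ : t₀ ∈ Icc a b)
    (hx : ∀ s ∈ Icc a b, x' s = x s) : Γ.IsSolution a b t₀ x₀ u v x' := by
  refine ⟨h.1.congr hx, h.2.1.congr_fun (fun s hs => by simp only [hx s hs]) measurableSet_Icc,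
    fun t ht => ?_⟩
  rw [hx t ht, h.2.2 t ht]
  congr 1
  refine intervalIntegral.integral_congr fun s hs => ?_
  simp only [hx s (uIcc_subset_Icc ht₀ ht hs)]

/-- On a short time interval a solution stays near its initial position. -/
lemma IsSolution.norm_sub_le {a b C : ℝ} {ξ : Euc n} {u : ℝ → P} {v : ℝ → Q} {x : ℝ → Euc n}
    (h : Γ.IsSolution a b a ξ u v x) (hC : Γ.SpeedBound C) (ha : 0 ≤ a) (hab : a ≤ b)
    (hb : b ≤ Γ.T) (hs : C * (b - a) ≤ 1 / 2) {τ : ℝ} (hτ : τ ∈ Icc a b) :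
    ‖x τ - ξ‖ ≤ 2 * C * (b - a) * (1 + ‖ξ‖) := by
  -- In place of Grönwall: bound the speed by its value at the point of largest norm, then absorb
  -- that norm using `C * (b - a) ≤ 1 / 2`.
  obtain ⟨τ₀, hτ₀, hmax⟩ := isCompact_Icc.exists_isMaxOn (nonempty_Icc.2 hab) h.1.norm
  have hC0 := hC.1
  have key : ∀ τ ∈ Icc a b, ‖x τ - ξ‖ ≤ C * (1 + ‖x τ₀‖) * (b - a) := fun τ hτ => by
    rw [h.2.2 τ hτ, add_sub_cancel_left]
    refine (intervalIntegral.norm_integral_le_of_norm_le_const (C := C * (1 + ‖x τ₀‖))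
      fun s hs => ?_).trans ?_
    · rw [uIoc_of_le hτ.1] at hs
      have hsI : s ∈ Icc a b := ⟨hs.1.le, hs.2.trans hτ.2⟩
      refine (hC.2 s ⟨ha.trans hsI.1, hsI.2.trans hb⟩ _ _ _).trans ?_
      gcongr
      exact hmax hsI
    · rw [abs_of_nonneg (sub_nonneg.2 hτ.1)]
      gcongr
      exact hτ.2
  have h0 := key τ₀ hτ₀
  have h1 : ‖x τ₀‖ ≤ ‖ξ‖ + ‖x τ₀ - ξ‖ := norm_le_insert' _ _
  have h2 : 1 + ‖x τ₀‖ ≤ 2 * (1 + ‖ξ‖) := by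
    have : C * (b - a) * (1 + ‖x τ₀‖) ≤ 1 / 2 * (1 + ‖x τ₀‖) := by gcongr
    linarith
  refine (key τ hτ).trans ?_
  have hba : 0 ≤ b - a := sub_nonneg.2 hab
  calc C * (1 + ‖x τ₀‖) * (b - a) ≤ C * (2 * (1 + ‖ξ‖)) * (b - a) := by gcongr
    _ = _ := by ring

/-! ### Extremal shift -/

/-- `y` on `[0,T]`, started at `(a, ω)`, is a limit of motions whose controls are at least as far
in the direction `ξ - ω`, at the positions `(a, ξ)`, as all the control values in `A`. -/
def Aim (Γ : DiffGame n P Q) (A : Set (P × Q)) (a : TimeInt Γ.T) (ξ ω : Euc n) :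
    Set C(TimeInt Γ.T, Euc n) :=
  closure {y | ∃ (u : ℝ → P) (v : ℝ → Q), Γ.IsMotion a ω u v y ∧ ∀ s, ∀ p ∈ A,
    inner ℝ (ξ - ω) (Γ.f a ξ p.1) ≤ inner ℝ (ξ - ω) (Γ.f a ξ (u s)) ∧
    inner ℝ (ξ - ω) (Γ.g a ξ p.2) ≤ inner ℝ (ξ - ω) (Γ.g a ξ (v s))}

/-- The restriction to `[a,b]` of a motion started at time `a`. -/
lemma IsMotion.exists_solution {a b : TimeInt Γ.T} (hab : a ≤ b) {ω : Euc n} {u : ℝ → P}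
    {v : ℝ → Q} {y : C(TimeInt Γ.T, Euc n)} (h : Γ.IsMotion a ω u v y) :
    ∃ z : ℝ → Euc n, Γ.IsSolution a b a ω u v z ∧ y b = z b := by
  obtain ⟨z, hz, hyz⟩ := h
  have := hz.restrict a.2 a.2.1 hab b.2.2
  have hω : z a = ω := by simpa using hz.2.2 a a.2
  rw [hω] at this
  exact ⟨z, this, hyz b⟩

/-- Evaluation at `b` is continuous, so the bound for genuine motions survives the closure. -/
lemma norm_sub_le_of_mem_Aim {C : ℝ} (hC : Γ.SpeedBound C) {A : Set (P × Q)}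
    {a b : TimeInt Γ.T} (hab : a ≤ b) (hs : C * ((b : ℝ) - a) ≤ 1 / 2) {ξ ω : Euc n}
    {y : C(TimeInt Γ.T, Euc n)} (hy : y ∈ Γ.Aim A a ξ ω) :
    ‖y b - ω‖ ≤ 2 * C * ((b : ℝ) - a) * (1 + ‖ω‖) := by
  have hcl : IsClosed {y : C(TimeInt Γ.T, Euc n) |
      ‖y b - ω‖ ≤ 2 * C * ((b : ℝ) - a) * (1 + ‖ω‖)} :=
    isClosed_le (by fun_prop) continuous_const
  refine closure_minimal ?_ hcl hy
  rintro y ⟨u, v, hm, -⟩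
  obtain ⟨z, hz, hyz⟩ := hm.exists_solution hab
  rw [mem_ofPred_eq, hyz]
  exact hz.norm_sub_le hC a.2.1 hab b.2.2 hs ⟨hab, le_rfl⟩

/-- The shift estimate for two solutions on a short interval `[a,b]`. -/
lemma IsSolution.norm_sub_sq_le {a b L M η : ℝ} {ξ ω : Euc n} {u u' : ℝ → P} {v v' : ℝ → Q}
    {x z : ℝ → Euc n} (hx : Γ.IsSolution a b a ξ u v x) (hz : Γ.IsSolution a b a ω u' v' z)
    (hab : a ≤ b) (hxb : ‖x b - ξ‖ ≤ M * (b - a)) (hzb : ‖z b - ω‖ ≤ M * (b - a))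
    (hfx : ∀ s ∈ Ico a b, ∀ p, ‖Γ.f s (x s) p - Γ.f a ξ p‖ ≤ η)
    (hgx : ∀ s ∈ Ico a b, ∀ q, ‖Γ.g s (x s) q - Γ.g a ξ q‖ ≤ η)
    (hfz : ∀ s ∈ Ico a b, ∀ p, ‖Γ.f s (z s) p - Γ.f a ω p‖ ≤ η)
    (hgz : ∀ s ∈ Ico a b, ∀ q, ‖Γ.g s (z s) q - Γ.g a ω q‖ ≤ η)
    (hLf : ∀ p, ‖Γ.f a ξ p - Γ.f a ω p‖ ≤ L * ‖ξ - ω‖)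
    (hLg : ∀ q, ‖Γ.g a ξ q - Γ.g a ω q‖ ≤ L * ‖ξ - ω‖)
    (hdu : ∀ s ∈ Ico a b, inner ℝ (ξ - ω) (Γ.f a ξ (u s)) ≤ inner ℝ (ξ - ω) (Γ.f a ξ (u' s)))
    (hdv : ∀ s ∈ Ico a b, inner ℝ (ξ - ω) (Γ.g a ξ (v s)) ≤ inner ℝ (ξ - ω) (Γ.g a ξ (v' s))) :
    ‖x b - z b‖ ^ 2 ≤ (1 + 4 * L * (b - a)) * ‖ξ - ω‖ ^ 2 +
      (b - a) * (8 * η * ‖ξ - ω‖ + 4 * M ^ 2 * (b - a)) := by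
  set s₀ := ξ - ω with hs₀
  have hba : 0 ≤ b - a := sub_nonneg.2 hab
  set F := fun s => Γ.f s (x s) (u s) + Γ.g s (x s) (v s)
  set G := fun s => Γ.f s (z s) (u' s) + Γ.g s (z s) (v' s)
  have hF : IntervalIntegrable F volume a b :=
    (hx.2.1.mono_set (uIcc_of_le hab).subset).intervalIntegrable
  have hG : IntervalIntegrable G volume a b :=
    (hz.2.1.mono_set (uIcc_of_le hab).subset).intervalIntegrable
  have hbI : b ∈ Icc a b := ⟨hab, le_rfl⟩
  have hI : x b - z b = s₀ + ∫ s in a..b, (F s - G s) := by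
    rw [intervalIntegral.integral_sub hF hG, hx.2.2 b hbI, hz.2.2 b hbI, hs₀]
    abel
  set I := ∫ s in a..b, (F s - G s)
  have hIn : ‖I‖ ≤ 2 * (M * (b - a)) := by
    have : I = (x b - ξ) - (z b - ω) := by
      rw [sub_sub_sub_comm, hI, hs₀]; abel
    rw [this]
    linarith [_root_.norm_sub_le (x b - ξ) (z b - ω)]
  -- Freezing each of the four velocity terms at time `a` costs `η`, and moving the two model terms
  -- from `ω` to `ξ` costs `L * ‖s₀‖` each. At the frozen position `ξ` the direction hypotheses make
  -- the remainder nonpositive.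
  have hpt : ∀ s ∈ Ioo a b, inner ℝ s₀ (F s - G s) ≤ 2 * L * ‖s₀‖ ^ 2 + 4 * η * ‖s₀‖ := by
    intro s hs
    have hs' : s ∈ Ico a b := Ioo_subset_Ico_self hs
    have bd : ∀ {w : Euc n} {c : ℝ}, ‖w‖ ≤ c → inner ℝ s₀ w ≤ ‖s₀‖ * c := fun {w c} hw =>
      (real_inner_le_norm _ _).trans (by gcongr)
    have e1 := bd (hfx s hs' (u s))
    have e2 := bd (hgx s hs' (v s))
    have e3 := bd (norm_sub_rev (Γ.f s (z s) (u' s)) _ ▸ hfz s hs' (u' s))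
    have e4 := bd (norm_sub_rev (Γ.g s (z s) (v' s)) _ ▸ hgz s hs' (v' s))
    have e5 := bd (hLf (u' s))
    have e6 := bd (hLg (v' s))
    have e7 := hdu s hs'
    have e8 := hdv s hs'
    simp only [F, G, inner_sub_right, inner_add_right] at *
    nlinarith
  have hint : inner ℝ s₀ I ≤ (b - a) * (2 * L * ‖s₀‖ ^ 2 + 4 * η * ‖s₀‖) := by
    have h1 : inner ℝ s₀ I = ∫ s in a..b, inner ℝ s₀ (F s - G s) :=
      ((innerSL ℝ s₀).intervalIntegral_comp_comm (hF.sub hG)).symm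
    have hi : IntervalIntegrable (fun s => inner ℝ s₀ (F s - G s)) volume a b := by
      have := hF.sub hG
      rw [intervalIntegrable_iff] at this ⊢
      exact (innerSL ℝ s₀).integrable_comp this
    rw [h1]
    refine (intervalIntegral.integral_mono_on_of_le_Ioo hab hi
      intervalIntegrable_const hpt).trans (le_of_eq ?_)
    rw [intervalIntegral.integral_const, smul_eq_mul]
  rw [hI, norm_add_sq_real]
  have hI2 : ‖I‖ ^ 2 ≤ (2 * (M * (b - a))) ^ 2 := by gcongr
  linarith

/-- The extremal shift estimate: if the controls of `x` take values in `A` and `y` aims at `A`,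
then the distance between `x` and `y` hardly grows over a short step. -/
lemma exists_shift_estimate [MetricSpace P] [CompactSpace P] [MetricSpace Q] [CompactSpace Q]
    (hf : AdmissibleDynamics Γ.T Γ.f) (hg : AdmissibleDynamics Γ.T Γ.g) {R : ℝ} (hR : 0 ≤ R) :
    ∃ l : ℝ, 0 ≤ l ∧ ∀ ε > 0, ∃ δ > 0, ∀ (a b : TimeInt Γ.T), a ≤ b → (b : ℝ) - a ≤ δ →
      ∀ (ξ ω : Euc n), ‖ξ‖ ≤ R → ‖ω‖ ≤ R → ∀ (A : Set (P × Q)) (u : ℝ → P) (v : ℝ → Q)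
      (x : ℝ → Euc n), Γ.IsSolution a b a ξ u v x → (∀ s ∈ Ico (a : ℝ) b, (u s, v s) ∈ A) →
      ∀ y ∈ Γ.Aim A a ξ ω,
        ‖x b - y b‖ ^ 2 ≤ (1 + l * ((b : ℝ) - a)) * ‖ξ - ω‖ ^ 2 + ε * ((b : ℝ) - a) := by
  obtain ⟨C, hC⟩ := exists_speedBound hf hg
  have hC0 := hC.1
  obtain ⟨L₁, hL₁⟩ := hf.lipschitz R
  obtain ⟨L₂, hL₂⟩ := hg.lipschitz R
  set L := |L₁| + |L₂| with hL
  refine ⟨4 * L, by positivity, fun ε hε => ?_⟩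
  -- Since `‖ξ - ω‖ ≤ 2 * R`, this makes `8 * η * ‖ξ - ω‖` at most `ε / 2`; the other half of `ε` is
  -- kept for `4 * M ^ 2 * h`.
  set η := ε / (32 * (R + 1)) with hη
  have hη0 : 0 < η := by positivity
  set M := 2 * C * (1 + R) with hM
  have hM0 : 0 ≤ M := by positivity
  obtain ⟨δ₁, hδ₁, H₁⟩ := hf.uniform_continuity (R + M) hη0
  obtain ⟨δ₂, hδ₂, H₂⟩ := hg.uniform_continuity (R + M) hη0
  set δ := min (1 / (2 * (C + 1))) (min 1 (min (min (δ₁ / 2) (δ₂ / 2))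
    (min (min (δ₁ / (2 * (M + 1))) (δ₂ / (2 * (M + 1)))) (ε / (8 * (M ^ 2 + 1)))))) with hδ
  have hδ0 : 0 < δ := by simp only [hδ, lt_min_iff]; refine ⟨?_, ?_, ⟨?_, ?_⟩, ⟨?_, ?_⟩, ?_⟩ <;>
    positivity
  refine ⟨δ, hδ0, fun a b hab hba ξ ω hξ hω A u v x hx hA y hy => ?_⟩
  have hab' : (a : ℝ) ≤ b := hab
  simp only [hδ, le_min_iff] at hba
  obtain ⟨h1, h2, ⟨h3, h4⟩, ⟨h5, h6⟩, h7⟩ := hba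
  set h := (b : ℝ) - a with hh
  have hh0 : 0 ≤ h := sub_nonneg.2 hab
  have hCs : C * h ≤ 1 / 2 := by
    rw [le_div_iff₀ (by positivity)] at h1
    nlinarith
  have hMδ₁ : M * h < δ₁ := by
    rw [le_div_iff₀ (by positivity)] at h5; nlinarith
  have hMδ₂ : M * h < δ₂ := by
    rw [le_div_iff₀ (by positivity)] at h6; nlinarith
  -- The estimate is a closed condition on `y b`, so genuine motions suffice.
  have hcl : IsClosed {y : C(TimeInt Γ.T, Euc n) |
      ‖x b - y b‖ ^ 2 ≤ (1 + 4 * L * h) * ‖ξ - ω‖ ^ 2 + ε * h} :=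
    isClosed_le (by fun_prop) continuous_const
  refine closure_minimal ?_ hcl hy
  rintro y ⟨u', v', hm, hd⟩
  obtain ⟨z, hz, hyz⟩ := hm.exists_solution hab
  rw [mem_ofPred_eq, hyz]
  have near : ∀ {ζ : Euc n} {u : ℝ → P} {v : ℝ → Q} {x : ℝ → Euc n}, ‖ζ‖ ≤ R →
      Γ.IsSolution a b a ζ u v x → ∀ s ∈ Icc (a : ℝ) b, ‖x s - ζ‖ ≤ M * h := by
    intro ζ u v x hζ hx s hs
    refine (hx.norm_sub_le hC a.2.1 hab b.2.2 hCs hs).trans ?_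
    calc 2 * C * h * (1 + ‖ζ‖) ≤ 2 * C * h * (1 + R) := by gcongr
      _ = M * h := by rw [hM]; ring
  have osc : ∀ {ζ : Euc n} {u : ℝ → P} {v : ℝ → Q} {x : ℝ → Euc n}, ‖ζ‖ ≤ R →
      Γ.IsSolution a b a ζ u v x → ∀ s ∈ Ico (a : ℝ) b,
      (∀ p, ‖Γ.f s (x s) p - Γ.f a ζ p‖ ≤ η) ∧ ∀ q, ‖Γ.g s (x s) q - Γ.g a ζ q‖ ≤ η := by
    intro ζ u v x hζ hx s hs
    have hn := near hζ hx s (Ico_subset_Icc_self hs)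
    have hsT : s ∈ Icc 0 Γ.T := ⟨a.2.1.trans hs.1, hs.2.le.trans b.2.2⟩
    have hxs : ‖x s‖ ≤ R + M := by
      have := norm_le_insert' (x s) ζ
      nlinarith
    have hsa : |s - a| ≤ h := by
      rw [abs_of_nonneg (sub_nonneg.2 hs.1)]; linarith [hs.2]
    exact ⟨H₁ s hsT a a.2 _ _ hxs (by linarith) (by linarith) (by linarith),
      H₂ s hsT a a.2 _ _ hxs (by linarith) (by linarith) (by linarith)⟩
  have hbI : (b : ℝ) ∈ Icc (a : ℝ) b := ⟨hab, le_rfl⟩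
  have main := hx.norm_sub_sq_le (L := L) hz hab' (near hξ hx b hbI) (near hω hz b hbI)
    (fun s hs => (osc hξ hx s hs).1) (fun s hs => (osc hξ hx s hs).2)
    (fun s hs => (osc hω hz s hs).1) (fun s hs => (osc hω hz s hs).2)
    (fun p => (hL₁ a a.2 ξ ω hξ hω p).trans (by
      gcongr; rw [hL]; linarith [le_abs_self L₁, abs_nonneg L₂]))
    (fun q => (hL₂ a a.2 ξ ω hξ hω q).trans (by
      gcongr; rw [hL]; linarith [le_abs_self L₂, abs_nonneg L₁]))
    (fun s hs => (hd s _ (hA s hs)).1) (fun s hs => (hd s _ (hA s hs)).2)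
  refine main.trans ?_
  rw [← hh]
  have hsn : ‖ξ - ω‖ ≤ 2 * R := (norm_sub_le _ _).trans (by linarith)
  have t1 : 8 * η * ‖ξ - ω‖ ≤ ε / 2 := by
    calc 8 * η * ‖ξ - ω‖ ≤ 8 * η * (2 * (R + 1)) := by gcongr; linarith
      _ = ε / 2 := by rw [hη]; field_simp; norm_num
  have t2 : 4 * M ^ 2 * h ≤ ε / 2 := by
    rw [le_div_iff₀ (by positivity)] at h7
    nlinarith
  have : h * (8 * η * ‖ξ - ω‖ + 4 * M ^ 2 * h) ≤ h * ε := by gcongr; linarith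
  linarith

end DiffGame

/-! ### Guides and their coding by vectors -/

/-- A guide: the model position `guide` and the promised payoffs `payoff`, together with a record
of the previous node of the partition: its time, the state and the model position there, and
whether no deviation had been observed up to that node. -/
structure GuideState (n : ℕ) where
  regular : Prop
  time : ℝ
  state : Euc n
  prevGuide : Euc n
  guide : Euc n
  payoff : ℝ × ℝ

/-- The record lives in a standard Borel space, which embeds in the line. Strategies may be
arbitrary functions, so a one-dimensional guide can store everything. -/
lemma GuideState.exists_injective (n : ℕ) : ∃ e : GuideState n → Euc 1, Function.Injective e := by
  classical
  obtain ⟨e, he⟩ := exists_measurableEmbedding_real (Bool × ℝ × Euc n × Euc n × Euc n × ℝ × ℝ)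
  refine ⟨fun z => EuclideanSpace.single 0
    (e (decide z.regular, z.time, z.state, z.prevGuide, z.guide, z.payoff)), fun z z' h => ?_⟩
  have h' := he.injective (by simpa using congrArg (fun w : Euc 1 => w 0) h)
  cases z
  cases z'
  simpa using h'

/-- The strategy with memory in an arbitrary type `M`, coded by vectors through `e` and `d`. -/
def GuideStrategy.ofMemory {T : ℝ} {n : ℕ} {A M : Type*} (e : M → Euc 1) (d : Euc 1 → M)
    (ctrl : TimeInt T → Euc n → M → A) (step : TimeInt T → TimeInt T → Euc n → M → M)
    (init : TimeInt T → Euc n → M) : GuideStrategy T n A where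
  m := 1
  control t x w := ctrl t x (d w)
  trans t' t x w := e (step t' t x (d w))
  init t x := e (init t x)

/-- The memory at the nodes of a partition along a motion. -/
def memorySeq {T : ℝ} {n : ℕ} {M : Type*} (step : TimeInt T → TimeInt T → Euc n → M → M)
    {t₀ : TimeInt T} (Δ : TimePartition T t₀) (z₀ : M) (x : ℝ → Euc n) : ℕ → M
  | 0 => z₀
  | k + 1 => step (Δ.pts (k + 1)) (Δ.pts k) (x (Δ.pts k)) (memorySeq step Δ z₀ x k)

lemma GuideStrategy.guide_ofMemory {T : ℝ} {n : ℕ} {A M : Type*} {e : M → Euc 1} {d : Euc 1 → M}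
    (hde : ∀ z, d (e z) = z) (ctrl : TimeInt T → Euc n → M → A)
    (step : TimeInt T → TimeInt T → Euc n → M → M) (init : TimeInt T → Euc n → M)
    {t₀ : TimeInt T} (Δ : TimePartition T t₀) (x₀ : Euc n) (x : ℝ → Euc n) (k : ℕ) :
    d ((GuideStrategy.ofMemory e d ctrl step init).guide Δ x₀ x k) =
      memorySeq step Δ (init t₀ x₀) x k := by
  induction k with
  | zero => exact hde _
  | succ k ih =>
    rw [memorySeq, ← ih]
    exact hde _

/-! ### Plans and tracking -/

namespace DiffGame

variable {n : ℕ} {P Q : Type*} {Γ : DiffGame n P Q}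

/-- A solution under the constant controls `p`, `q` leads from `(a, ξ)` to `(b, ξ')`. -/
def Leads (Γ : DiffGame n P Q) (p : P) (q : Q) (a : ℝ) (ξ : Euc n) (b : ℝ) (ξ' : Euc n) : Prop :=
  ∃ (u : ℝ → P) (v : ℝ → Q) (x : ℝ → Euc n), Γ.IsSolution a b a ξ u v x ∧
    (∀ s ∈ Ico a b, u s = p ∧ v s = q) ∧ x b = ξ'

/-- Rules for the play of one player. As functions of time, state and model position, `uc` and
`vc` are the controls that the players apply, and `A` is the set of pairs of controls that may
occur while the other player deviates. The model position is moved by `nextC` as long as no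
deviation was observed, and by `nextP`, which does not increase the payoff `π`, afterwards. -/
structure Plan (Γ : DiffGame n P Q) (S : TimeInt Γ.T × Euc n → Set (ℝ × ℝ))
    (π : ℝ × ℝ → ℝ) where
  uc : ℝ → Euc n → Euc n → P
  vc : ℝ → Euc n → Euc n → Q
  A : ℝ → Euc n → Euc n → Set (P × Q)
  nextC : TimeInt Γ.T → TimeInt Γ.T → Euc n → ℝ × ℝ → Euc n
  nextP : TimeInt Γ.T → TimeInt Γ.T → Euc n → Euc n → ℝ × ℝ → Euc n × (ℝ × ℝ)
  spec_nextC : ∀ a b : TimeInt Γ.T, a ≤ b → ∀ ξ ω, ∀ J ∈ S (a, ω), J ∈ S (b, nextC a b ω J) ∧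
    ∃ y ∈ Γ.Aim {(uc a ξ ω, vc a ξ ω)} a ξ ω, y b = nextC a b ω J
  spec_nextP : ∀ a b : TimeInt Γ.T, a ≤ b → ∀ ξ ω, ∀ J ∈ S (a, ω),
    (nextP a b ξ ω J).2 ∈ S (b, (nextP a b ξ ω J).1) ∧ π (nextP a b ξ ω J).2 ≤ π J ∧
    ∃ y ∈ Γ.Aim (A a ξ ω) a ξ ω, y b = (nextP a b ξ ω J).1

namespace Plan

variable {S : TimeInt Γ.T × Euc n → Set (ℝ × ℝ)} {π : ℝ × ℝ → ℝ} (p : Γ.Plan S π)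

/-- No deviation has been observed up to the position `(t, x)`. -/
def OnTrack (z : GuideState n) (t : ℝ) (x : Euc n) : Prop :=
  z.regular ∧ Γ.Leads (p.uc z.time z.state z.prevGuide) (p.vc z.time z.state z.prevGuide)
    z.time z.state t x

open Classical in
/-- The transition of the guide. -/
noncomputable def step (t' t : TimeInt Γ.T) (x : Euc n) (z : GuideState n) : GuideState n :=
  if p.OnTrack z t x then
    ⟨True, t, x, z.guide, p.nextC t t' z.guide z.payoff, z.payoff⟩
  else
    ⟨False, t, x, z.guide, (p.nextP t t' x z.guide z.payoff).1,
      (p.nextP t t' x z.guide z.payoff).2⟩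

/-- The guides at the nodes of a partition along a motion from `(t₀, x₀)`. -/
noncomputable def seq {t₀ : TimeInt Γ.T} (Δ : TimePartition Γ.T t₀) (x₀ : Euc n) (J₀ : ℝ × ℝ)
    (x : ℝ → Euc n) : ℕ → GuideState n :=
  memorySeq p.step Δ ⟨True, t₀, x₀, x₀, x₀, J₀⟩ x

/-- Along every motion with controls in `A`, the guide ends near the state of the system. -/
theorem tracking [MetricSpace P] [CompactSpace P] [MetricSpace Q] [CompactSpace Q]
    (hf : AdmissibleDynamics Γ.T Γ.f) (hg : AdmissibleDynamics Γ.T Γ.g)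
    (t₀ : TimeInt Γ.T) (x₀ : Euc n) {J₀ : ℝ × ℝ} (hJ₀ : J₀ ∈ S (t₀, x₀)) :
    ∃ R : ℝ, ∀ ε > 0, ∃ δ > 0, ∀ Δ : TimePartition Γ.T t₀, Δ.MeshLE δ →
      ∀ (u : ℝ → P) (v : ℝ → Q) (x : ℝ → Euc n), Γ.IsSolution t₀ Γ.T t₀ x₀ u v x →
      (∀ k < Δ.r, ∀ s ∈ Ico (Δ.pts k : ℝ) (Δ.pts (k + 1)),
        (u s, v s) ∈ p.A (Δ.pts k) (x (Δ.pts k)) (p.seq Δ x₀ J₀ x k).guide) →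
      ‖x Γ.T‖ ≤ R ∧ ‖(p.seq Δ x₀ J₀ x Δ.r).guide‖ ≤ R ∧
      (p.seq Δ x₀ J₀ x Δ.r).payoff ∈ S (Δ.pts Δ.r, (p.seq Δ x₀ J₀ x Δ.r).guide) ∧
      π (p.seq Δ x₀ J₀ x Δ.r).payoff ≤ π J₀ ∧
      (p.OnTrack (p.seq Δ x₀ J₀ x Δ.r) Γ.T (x Γ.T) → (p.seq Δ x₀ J₀ x Δ.r).payoff = J₀) ∧
      ‖x Γ.T - (p.seq Δ x₀ J₀ x Δ.r).guide‖ ^ 2 ≤ ε := by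
  obtain ⟨C, hC⟩ := exists_speedBound hf hg
  have hC0 := hC.1
  have hT : 0 ≤ Γ.T := t₀.2.1.trans t₀.2.2
  set R := (1 + ‖x₀‖) * Real.exp (2 * C * Γ.T) with hR
  have hR0 : 0 ≤ R := by positivity
  obtain ⟨l, hl, H⟩ := exists_shift_estimate hf hg hR0
  refine ⟨R, fun ε hε => ?_⟩
  set M := 2 * C * (1 + R) with hM
  have hM0 : 0 ≤ M := by positivity
  -- `κ * h` bounds the growth of the squared distance over a step of length `h ≤ 1` with
  -- uncontrolled directions: state and model each move at most `M * h` from positions at distance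
  -- at most `2 * R`.
  set κ := 8 * M * R + 4 * M ^ 2 with hκ
  have hκ0 : 0 ≤ κ := by positivity
  set E := Real.exp (l * Γ.T) with hE
  have hE0 : 0 < E := Real.exp_pos _
  -- The accumulated shift errors get one half of `ε`; `Γ.T + 1` keeps the denominator positive when
  -- `Γ.T = 0`.
  set ε' := ε / (2 * E * (Γ.T + 1)) with hε'
  have hε'0 : 0 < ε' := by positivity
  obtain ⟨δ₁, hδ₁, H⟩ := H ε' hε'0
  set δ := min δ₁ (min 1 (min (1 / (2 * (C + 1))) (ε / (2 * E * (κ + 1))))) with hδ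
  have hδ0 : 0 < δ := by
    simp only [hδ, lt_min_iff]; refine ⟨hδ₁, ?_, ?_, ?_⟩ <;> positivity
  have hδ₁' : δ ≤ δ₁ := min_le_left _ _
  have hδ1 : δ ≤ 1 := (min_le_right _ _).trans (min_le_left _ _)
  have hδC : C * δ ≤ 1 / 2 := by
    have : δ ≤ 1 / (2 * (C + 1)) :=
      (min_le_right _ _).trans ((min_le_right _ _).trans (min_le_left _ _))
    rw [le_div_iff₀ (by positivity)] at this
    nlinarith
  have hδκ : E * (κ * δ) ≤ ε / 2 := by
    have : δ ≤ ε / (2 * E * (κ + 1)) :=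
      (min_le_right _ _).trans ((min_le_right _ _).trans (min_le_right _ _))
    rw [le_div_iff₀ (by positivity)] at this
    nlinarith [mul_pos hδ0 hE0]
  refine ⟨δ, hδ0, fun Δ hΔ u v x hx hA => ?_⟩
  set z := p.seq Δ x₀ J₀ x with hz
  have zsucc : ∀ k, z (k + 1) = p.step (Δ.pts (k + 1)) (Δ.pts k) (x (Δ.pts k)) (z k) :=
    fun k => rfl
  have ht₀I : (t₀ : ℝ) ∈ Icc (t₀ : ℝ) Γ.T := ⟨le_rfl, t₀.2.2⟩
  have hxt₀ : x t₀ = x₀ := by simpa using hx.2.2 t₀ ht₀I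
  have bound : ∀ {t : TimeInt Γ.T} {w : Euc n},
      1 + ‖w‖ ≤ (1 + ‖x₀‖) * Real.exp (2 * C * (t - t₀)) → ‖w‖ ≤ R := by
    intro t w hw
    have : (1 + ‖x₀‖) * Real.exp (2 * C * (t - t₀)) ≤ R := by
      rw [hR]; gcongr; linarith [t.2.2, t₀.2.1]
    linarith
  -- A discrete Grönwall step, used alike for the state and the model. It keeps both in a ball of
  -- radius `R` that does not depend on the partition.
  have grow : ∀ {a b : TimeInt Γ.T} {w w' : Euc n}, (a : ℝ) ≤ b →
      1 + ‖w‖ ≤ (1 + ‖x₀‖) * Real.exp (2 * C * (a - t₀)) →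
      ‖w' - w‖ ≤ 2 * C * ((b : ℝ) - a) * (1 + ‖w‖) →
      1 + ‖w'‖ ≤ (1 + ‖x₀‖) * Real.exp (2 * C * (b - t₀)) := by
    intro a b w w' hab hw hw'
    have hab0 := mul_nonneg (mul_nonneg zero_le_two hC0) (sub_nonneg.2 hab)
    have h1 : ‖w'‖ ≤ ‖w‖ + ‖w' - w‖ := norm_le_insert' _ _
    have h2 : 1 + 2 * C * ((b : ℝ) - a) ≤ Real.exp (2 * C * ((b : ℝ) - a)) := by
      linarith [Real.add_one_le_exp (2 * C * ((b : ℝ) - a))]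
    calc 1 + ‖w'‖ ≤ (1 + ‖w‖) * (1 + 2 * C * ((b : ℝ) - a)) := by linarith
      _ ≤ ((1 + ‖x₀‖) * Real.exp (2 * C * (a - t₀))) * Real.exp (2 * C * ((b : ℝ) - a)) := by
        gcongr
      _ = _ := by rw [mul_assoc, ← Real.exp_add]; ring_nf
  -- Two distance bounds run in parallel: one without `κ * δ`, valid while no deviation is observed,
  -- and one with it, valid always. The sharper one is what allows the single late step to be
  -- charged only once.
  have key : ∀ k ≤ Δ.r, (t₀ : ℝ) ≤ Δ.pts k ∧
      1 + ‖x (Δ.pts k)‖ ≤ (1 + ‖x₀‖) * Real.exp (2 * C * (Δ.pts k - t₀)) ∧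
      1 + ‖(z k).guide‖ ≤ (1 + ‖x₀‖) * Real.exp (2 * C * (Δ.pts k - t₀)) ∧
      (z k).payoff ∈ S (Δ.pts k, (z k).guide) ∧ π (z k).payoff ≤ π J₀ ∧
      (p.OnTrack (z k) (Δ.pts k) (x (Δ.pts k)) → (z k).payoff = J₀ ∧
        ‖x (Δ.pts k) - (z k).guide‖ ^ 2 ≤
          Real.exp (l * (Δ.pts k - t₀)) * (ε' * (Δ.pts k - t₀))) ∧
      ‖x (Δ.pts k) - (z k).guide‖ ^ 2 ≤
        Real.exp (l * (Δ.pts k - t₀)) * (ε' * (Δ.pts k - t₀) + κ * δ) := by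
    intro k
    induction k with
    | zero =>
      intro _
      have hz0 : z 0 = ⟨True, t₀, x₀, x₀, x₀, J₀⟩ := rfl
      rw [hz0, Δ.first, hxt₀]
      simp only [sub_self, mul_zero, Real.exp_zero, mul_one, norm_zero]
      refine ⟨le_rfl, le_rfl, le_rfl, hJ₀, le_rfl, fun _ => ⟨trivial, by norm_num⟩, ?_⟩
      have : 0 ≤ κ * δ := by positivity
      linarith
    | succ k ih =>
      intro hk
      obtain ⟨hta, hxk, hwk, hJ, hπ, hon, he⟩ := ih (by omega)
      rw [zsucc]
      set a := Δ.pts k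
      set b := Δ.pts (k + 1)
      set ξ := x a
      set ω := (z k).guide
      have hablt : a < b := Δ.increasing k hk
      have hab : a ≤ b := hablt.le
      have hab' : (a : ℝ) ≤ b := hab
      have hba : (b : ℝ) - a ≤ δ := hΔ k hk
      have hba0 : 0 ≤ (b : ℝ) - a := sub_nonneg.2 hab
      have hCs : C * ((b : ℝ) - a) ≤ 1 / 2 := (by gcongr : _ ≤ C * δ).trans hδC
      have hsol : Γ.IsSolution a b a ξ u v x := hx.restrict ht₀I hta hab b.2.2
      have hξ := bound hxk
      have hω := bound hwk
      have hxb := hsol.norm_sub_le hC a.2.1 hab b.2.2 hCs ⟨hab, le_rfl⟩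
      have hxb' := grow hab' hxk hxb
      have hMx : ∀ {w w' : Euc n}, ‖w‖ ≤ R → ‖w' - w‖ ≤ 2 * C * ((b : ℝ) - a) * (1 + ‖w‖) →
          ‖w' - w‖ ≤ M * ((b : ℝ) - a) := by
        intro w w' hw hw'
        refine hw'.trans ?_
        calc 2 * C * ((b : ℝ) - a) * (1 + ‖w‖) ≤ 2 * C * ((b : ℝ) - a) * (1 + R) := by gcongr
          _ = _ := by rw [hM]; ring
      have hexp : Real.exp (l * (a - t₀)) * (1 + l * ((b : ℝ) - a)) ≤
          Real.exp (l * (b - t₀)) := by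
        calc _ ≤ Real.exp (l * (a - t₀)) * Real.exp (l * ((b : ℝ) - a)) := by
              gcongr; linarith [Real.add_one_le_exp (l * ((b : ℝ) - a))]
          _ = _ := by rw [← Real.exp_add]; ring_nf
      have hexp1 : 1 ≤ Real.exp (l * (b - t₀)) := Real.one_le_exp (by
        apply mul_nonneg hl; linarith)
      -- the effect of a regular step on a bound for the distance
      have advance : ∀ {X Y : ℝ} {y' : ℝ}, 0 ≤ X →
          Y ≤ Real.exp (l * (a - t₀)) * (ε' * (a - t₀) + X) →
          y' ≤ (1 + l * ((b : ℝ) - a)) * Y + ε' * ((b : ℝ) - a) →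
          y' ≤ Real.exp (l * (b - t₀)) * (ε' * (b - t₀) + X) := by
        intro X Y y' hX hY hy'
        have hX' : 0 ≤ ε' * ((a : ℝ) - t₀) + X := by
          have := mul_nonneg hε'0.le (sub_nonneg.2 hta); linarith
        have h1 : (1 + l * ((b : ℝ) - a)) * Y ≤
            Real.exp (l * (b - t₀)) * (ε' * (a - t₀) + X) := by
          calc _ ≤ (1 + l * ((b : ℝ) - a)) *
                (Real.exp (l * (a - t₀)) * (ε' * (a - t₀) + X)) := by
                gcongr
            _ = (Real.exp (l * (a - t₀)) * (1 + l * ((b : ℝ) - a))) *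
                (ε' * (a - t₀) + X) := by ring
            _ ≤ _ := by gcongr
        have h2 : ε' * ((b : ℝ) - a) ≤ Real.exp (l * (b - t₀)) * (ε' * ((b : ℝ) - a)) :=
          le_mul_of_one_le_left (by positivity) hexp1
        calc y' ≤ _ := hy'
          _ ≤ _ := add_le_add h1 h2
          _ = _ := by ring
      by_cases hOn : p.OnTrack (z k) a ξ
      · obtain ⟨hJeq, heOn⟩ := hon hOn
        obtain ⟨hS', y, hy, hyb⟩ := p.spec_nextC a b hab ξ ω _ hJ
        rw [step, if_pos hOn]
        have hwb := norm_sub_le_of_mem_Aim hC hab hCs hy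
        rw [hyb] at hwb
        refine ⟨hta.trans hab', hxb', grow hab' hwk hwb, hS', hπ, ?_, ?_⟩
        -- Being on track at `b` supplies a solution `x'` with the prescribed controls and the same
        -- endpoint; the shift estimate is applied to `x'`, whatever the true controls were.
        · rintro ⟨-, u', v', x', hx', huv, hx'b⟩
          refine ⟨hJeq, ?_⟩
          have := H a b hab (hba.trans hδ₁') ξ ω hξ hω _ u' v' x' hx'
            (fun s hs => by
              rw [mem_singleton_iff, (huv s hs).1, (huv s hs).2]) y hy
          rw [hyb, hx'b] at this
          simpa using advance (X := 0) le_rfl (by simpa using heOn) this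
        -- The opponent may have deviated during this very step, so only speed bounds are available
        -- here.
        · have h1 : ‖x b - p.nextC a b ω (z k).payoff‖ ≤
              ‖ξ - ω‖ + 2 * (M * ((b : ℝ) - a)) := by
            have e1 := hMx hξ hxb
            have e2 := hMx hω hwb
            have : x b - p.nextC a b ω (z k).payoff =
                (ξ - ω) + (x b - ξ) - (p.nextC a b ω (z k).payoff - ω) := by abel
            rw [this]
            linarith [_root_.norm_sub_le ((ξ - ω) + (x b - ξ))
              (p.nextC a b ω (z k).payoff - ω), norm_add_le (ξ - ω) (x b - ξ)]
          have hsn : ‖ξ - ω‖ ≤ 2 * R := (_root_.norm_sub_le _ _).trans (by linarith)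
          have h2 : ‖x b - p.nextC a b ω (z k).payoff‖ ^ 2 ≤
              ‖ξ - ω‖ ^ 2 + κ * ((b : ℝ) - a) := by
            calc _ ≤ (‖ξ - ω‖ + 2 * (M * ((b : ℝ) - a))) ^ 2 := by gcongr
              _ = ‖ξ - ω‖ ^ 2 + (4 * M * ((b : ℝ) - a)) * ‖ξ - ω‖ +
                  4 * M ^ 2 * ((b : ℝ) - a) * ((b : ℝ) - a) := by ring
              _ ≤ ‖ξ - ω‖ ^ 2 + (4 * M * ((b : ℝ) - a)) * (2 * R) +
                  4 * M ^ 2 * ((b : ℝ) - a) * 1 := by gcongr; linarith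
              _ = _ := by rw [hκ]; ring
          have h3 : κ * ((b : ℝ) - a) ≤ κ * δ := by gcongr
          have h4 : ‖ξ - ω‖ ^ 2 ≤ Real.exp (l * (b - t₀)) * (ε' * (b - t₀)) := by
            refine heOn.trans ?_
            have : 0 ≤ (a : ℝ) - t₀ := sub_nonneg.2 hta
            gcongr
          have h5 : κ * δ ≤ Real.exp (l * (b - t₀)) * (κ * δ) :=
            le_mul_of_one_le_left (by positivity) hexp1
          simp only
          linarith
      -- In punishment the true controls lie in `p.A`, and the estimate applies to the motion
      -- itself. The regular flag stays false from here on.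
      · obtain ⟨hS', hπ', y, hy, hyb⟩ := p.spec_nextP a b hab ξ ω _ hJ
        rw [step, if_neg hOn]
        have hwb := norm_sub_le_of_mem_Aim hC hab hCs hy
        rw [hyb] at hwb
        refine ⟨hta.trans hab', hxb', grow hab' hwk hwb, hS', hπ'.trans hπ, fun h => h.1.elim, ?_⟩
        have := H a b hab (hba.trans hδ₁') ξ ω hξ hω _ u v x hsol (hA k hk) y hy
        rw [hyb] at this
        exact advance (by positivity) he this
  obtain ⟨-, h1, h2, h3, h4, h5, h6⟩ := key Δ.r le_rfl
  rw [Δ.last] at h5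
  refine ⟨?_, bound h2, h3, h4, fun h => (h5 h).1, ?_⟩
  · rw [← Δ.last]; exact bound h1
  rw [Δ.last] at h6
  refine h6.trans ?_
  have hE' : Real.exp (l * (Γ.T - t₀)) ≤ E := by
    rw [hE]; gcongr; linarith [t₀.2.1]
  have hTt : 0 ≤ Γ.T - t₀ := sub_nonneg.2 t₀.2.2
  calc _ ≤ E * (ε' * (Γ.T + 1) + κ * δ) := by
        gcongr; linarith [t₀.2.1]
    _ = E * (ε' * (Γ.T + 1)) + E * (κ * δ) := by ring
    _ ≤ ε / 2 + ε / 2 := by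
        refine add_le_add (le_of_eq ?_) hδκ
        rw [hε']
        field_simp
    _ = ε := by ring

end Plan

end DiffGame

/-! ### Existence of joint step motions -/

namespace TimePartition

variable {T : ℝ} {t₀ : TimeInt T}

lemma pts_le_pts (Δ : TimePartition T t₀) {j k : ℕ} (hjk : j ≤ k) (hk : k ≤ Δ.r) :
    Δ.pts j ≤ Δ.pts k := by
  induction k, hjk using Nat.le_induction with
  | base => exact le_rfl
  | succ k _ ih => exact (ih (by omega)).trans (Δ.increasing k hk).le

lemma first_le_pts (Δ : TimePartition T t₀) {k : ℕ} (hk : k ≤ Δ.r) : t₀ ≤ Δ.pts k := by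
  simpa [Δ.first] using Δ.pts_le_pts (Nat.zero_le k) hk

lemma exists_meshLE (t₀ : TimeInt T) {δ : ℝ} (hδ : 0 < δ) :
    ∃ Δ : TimePartition T t₀, Δ.MeshLE δ := by
  rcases t₀.2.2.eq_or_lt with h | h
  · exact ⟨⟨0, fun _ => t₀, rfl, h, fun k hk => by omega⟩, fun k hk => absurd hk (Nat.not_lt_zero k)⟩
  obtain ⟨N, hN⟩ := exists_nat_gt ((T - t₀) / δ)
  have hT : 0 ≤ T := t₀.2.1.trans t₀.2.2
  have hN0 : (0 : ℝ) < N := lt_of_le_of_lt (div_nonneg (by linarith) hδ.le) hN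
  set c := (T - t₀) / N with hc
  have hc0 : 0 < c := div_pos (by linarith) hN0
  have hcN : N * c = T - t₀ := by rw [hc]; field_simp
  have hcδ : c ≤ δ := by
    rw [hc, div_le_iff₀ hN0]; rw [div_lt_iff₀ hδ] at hN; linarith
  have val : ∀ k : ℕ, k ≤ N → ((projIcc 0 T hT (t₀ + k * c) : TimeInt T) : ℝ) = t₀ + k * c := by
    intro k hk
    have hk' : (k : ℝ) * c ≤ N * c := by gcongr
    have hk0 : 0 ≤ (k : ℝ) * c := by positivity
    rw [projIcc_of_mem hT ⟨by linarith [t₀.2.1], by linarith⟩]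
  refine ⟨⟨N, fun k => projIcc 0 T hT (t₀ + k * c), Subtype.ext ?_, ?_, fun k hk => ?_⟩,
    fun k hk => ?_⟩
  · rw [val 0 (Nat.zero_le _)]; simp
  · rw [val N le_rfl]; linarith
  · rw [← Subtype.coe_lt_coe, val k hk.le, val (k + 1) hk]; push_cast; linarith
  · change k < N at hk
    rw [val k hk.le, val (k + 1) hk]; push_cast; linarith

end TimePartition

/-- Strategies are nonanticipating: a guide depends only on states at earlier nodes, so extending a
motion does not change the controls already formed. -/
lemma GuideStrategy.guide_congr {T : ℝ} {n : ℕ} {A : Type*} (U : GuideStrategy T n A)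
    {t₀ : TimeInt T} (Δ : TimePartition T t₀) (x₀ : Euc n) {x x' : ℝ → Euc n} {k : ℕ}
    (h : ∀ j < k, x (Δ.pts j) = x' (Δ.pts j)) : U.guide Δ x₀ x k = U.guide Δ x₀ x' k := by
  induction k with
  | zero => rfl
  | succ k ih =>
    rw [GuideStrategy.guide, GuideStrategy.guide, ih fun j hj => h j (by omega), h k (by omega)]

namespace DiffGame

variable {n : ℕ} {P Q : Type*} {Γ : DiffGame n P Q}

lemma IsSolution.concat {a c b : ℝ} {x₀ : Euc n} {u : ℝ → P} {v : ℝ → Q} {x : ℝ → Euc n}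
    (h₁ : Γ.IsSolution a c a x₀ u v x) (h₂ : Γ.IsSolution c b c (x c) u v x) (hac : a ≤ c)
    (hcb : c ≤ b) : Γ.IsSolution a b a x₀ u v x := by
  have hU : Icc a b = Icc a c ∪ Icc c b := (Icc_union_Icc_eq_Icc hac hcb).symm
  refine ⟨?_, ?_, fun t ht => ?_⟩
  · rw [hU]
    exact h₁.1.union_of_isClosed h₂.1 isClosed_Icc isClosed_Icc
  · rw [hU]
    exact h₁.2.1.union h₂.2.1
  · rcases le_total t c with htc | htc
    · exact h₁.2.2 t ⟨ht.1, htc⟩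
    · rw [h₂.2.2 t ⟨htc, ht.2⟩, h₁.2.2 c ⟨hac, le_rfl⟩, add_assoc,
        intervalIntegral.integral_add_adjacent_intervals
          (h₁.2.1.mono_set (uIcc_of_le hac).subset).intervalIntegrable
          (h₂.2.1.mono_set ((uIcc_of_le htc).subset.trans
            (Icc_subset_Icc_right ht.2))).intervalIntegrable]

/-- The two solutions agree at `c`, so the state may switch after `c` while the controls switch at
`c`, as the half-open steps of a strategy require. -/
lemma IsSolution.glue {a c b : ℝ} {x₀ : Euc n} {u u' : ℝ → P} {v v' : ℝ → Q} {x z : ℝ → Euc n}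
    (h₁ : Γ.IsSolution a c a x₀ u v x) (h₂ : Γ.IsSolution c b c (x c) u' v' z) (hac : a ≤ c)
    (hcb : c ≤ b) : Γ.IsSolution a b a x₀ (fun s => if s < c then u s else u' s)
      (fun s => if s < c then v s else v' s) (fun s => if s ≤ c then x s else z s) := by
  have haI : a ∈ Icc a c := ⟨le_rfl, hac⟩
  have hcI : c ∈ Icc c b := ⟨le_rfl, hcb⟩
  have hzc : z c = x c := by simpa using h₂.2.2 c hcI
  refine IsSolution.concat ((h₁.congr_controls haI ?_ ?_).congr_state haI ?_)
    ((IsSolution.congr_controls (u := u') (v := v') (x := z) ?_ hcI ?_ ?_).congr_state hcI ?_)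
    hac hcb
  · exact fun s hs => if_pos hs.2
  · exact fun s hs => if_pos hs.2
  · exact fun s hs => if_pos hs.2
  · simpa using h₂
  · exact fun s hs => if_neg hs.1.not_gt
  · exact fun s hs => if_neg hs.1.not_gt
  · intro s hs
    rcases hs.1.eq_or_lt with rfl | h
    · simp [hzc]
    · exact if_neg h.not_ge

/-- Solutions under constant controls exist on short time intervals, of a uniform length. -/
lemma exists_solution_const [TopologicalSpace P] [TopologicalSpace Q]
    (hf : AdmissibleDynamics Γ.T Γ.f) (hg : AdmissibleDynamics Γ.T Γ.g) :
    ∃ δ > 0, ∀ a b : ℝ, 0 ≤ a → a ≤ b → b ≤ Γ.T → b - a ≤ δ → ∀ (ξ : Euc n) (p : P) (q : Q),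
      ∃ x, Γ.IsSolution a b a ξ (fun _ => p) (fun _ => q) x := by
  obtain ⟨C, hC0, hC⟩ := exists_speedBound hf hg
  refine ⟨1 / (2 * (C + 1)), by positivity, fun a b ha hab hb hba ξ p q => ?_⟩
  have hba' : C * (b - a) ≤ 1 / 2 := by
    rw [le_div_iff₀ (by positivity)] at hba
    linarith [sub_nonneg.2 hab]
  have hsub : Icc a b ⊆ Icc 0 Γ.T := Icc_subset_Icc ha hb
  -- On the ball of radius `r` about `ξ` the speed is at most `2 * C * r`, so the Picard–Lindelöf
  -- time is at least `1 / (2 * (C + 1))`, independently of `ξ`.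
  set r : ℝ := 1 + ‖ξ‖ with hr
  have hr0 : 0 ≤ r := by positivity
  obtain ⟨L₁, hL₁⟩ := hf.lipschitz (‖ξ‖ + r)
  obtain ⟨L₂, hL₂⟩ := hg.lipschitz (‖ξ‖ + r)
  set F : ℝ → Euc n → Euc n := fun s y => Γ.f s y p + Γ.g s y q with hF
  have hcont : ContinuousOn (fun z : ℝ × Euc n => F z.1 z.2) (Icc a b ×ˢ univ) := by
    refine ContinuousOn.add ?_ ?_
    · exact hf.cont.comp (f := fun z : ℝ × Euc n => (z.1, z.2, p)) (by fun_prop)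
        fun z hz => ⟨hsub hz.1, mem_univ _⟩
    · exact hg.cont.comp (f := fun z : ℝ × Euc n => (z.1, z.2, q)) (by fun_prop)
        fun z hz => ⟨hsub hz.1, mem_univ _⟩
  have hball : ∀ y ∈ Metric.closedBall ξ r, ‖y‖ ≤ ‖ξ‖ + r := fun y hy => by
    rw [mem_closedBall_iff_norm] at hy
    linarith [norm_le_insert' y ξ]
  have hPL : IsPicardLindelof F (⟨a, le_rfl, hab⟩ : Icc a b) ξ ⟨r, hr0⟩ 0
      ⟨C * (2 * r), by positivity⟩ (Real.toNNReal (L₁ + L₂)) := by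
    refine ⟨fun t ht => ?_, fun y _ => ?_, fun t ht y hy => ?_, ?_⟩
    · refine LipschitzOnWith.of_dist_le_mul fun y hy z hz => ?_
      have h1 := hL₁ t (hsub ht) y z (hball y hy) (hball z hz) p
      have h2 := hL₂ t (hsub ht) y z (hball y hy) (hball z hz) q
      rw [dist_eq_norm, dist_eq_norm]
      calc ‖F t y - F t z‖ = ‖(Γ.f t y p - Γ.f t z p) + (Γ.g t y q - Γ.g t z q)‖ := by
            rw [hF]; congr 1; simp only; abel
        _ ≤ (L₁ + L₂) * ‖y - z‖ := (norm_add_le _ _).trans (by linarith)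
        _ ≤ _ := by gcongr; exact Real.le_coe_toNNReal _
    · exact hcont.comp (f := fun t => (t, y)) (by fun_prop) fun t ht => ⟨ht, mem_univ _⟩
    · refine (hC t (hsub ht) y p q).trans ?_
      change C * (1 + ‖y‖) ≤ C * (2 * r)
      have := hball y hy
      gcongr
      linarith
    · change C * (2 * r) * max (b - a) (a - a) ≤ r - 0
      rw [sub_self, max_eq_left (sub_nonneg.2 hab), sub_zero]
      nlinarith
  obtain ⟨x, hxa, hx⟩ := hPL.exists_eq_forall_mem_Icc_hasDerivWithinAt₀
  have hxc : ContinuousOn x (Icc a b) := fun t ht => (hx t ht).continuousWithinAt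
  have hFc : ContinuousOn (fun s => F s (x s)) (Icc a b) :=
    hcont.comp (f := fun s => (s, x s)) (continuousOn_id.prodMk hxc) fun t ht => ⟨ht, mem_univ _⟩
  refine ⟨x, hxc, hFc.integrableOn_Icc, fun t ht => ?_⟩
  have htb : Icc a t ⊆ Icc a b := Icc_subset_Icc_right ht.2
  rw [intervalIntegral.integral_eq_sub_of_hasDeriv_right_of_le ht.1 (hxc.mono htb) (fun s hs => ?_)
    ((hFc.mono (by rwa [uIcc_of_le ht.1])).intervalIntegrable)]
  · simp only at hxa
    rw [hxa]; abel
  · exact ((hx s ⟨hs.1.le, hs.2.le.trans ht.2⟩).hasDerivAt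
      (Icc_mem_nhds hs.1 (hs.2.trans_le ht.2))).hasDerivWithinAt

/-- Under any pair of strategies there is a joint motion with an arbitrarily fine partition. -/
lemma exists_stepMotionC [TopologicalSpace P] [TopologicalSpace Q] [Nonempty P] [Nonempty Q]
    [MeasurableSpace P] [MeasurableSpace Q]
    (hf : AdmissibleDynamics Γ.T Γ.f) (hg : AdmissibleDynamics Γ.T Γ.g)
    (U : GuideStrategy Γ.T n P) (V : GuideStrategy Γ.T n Q) (t₀ : TimeInt Γ.T) (x₀ : Euc n)
    {δ : ℝ} (hδ : 0 < δ) :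
    ∃ (Δ : TimePartition Γ.T t₀) (x : ℝ → Euc n), Δ.MeshLE δ ∧ Γ.IsStepMotionC t₀ x₀ U V Δ x := by
  obtain ⟨δ', hδ', H⟩ := exists_solution_const hf hg
  obtain ⟨Δ, hΔ⟩ := TimePartition.exists_meshLE t₀ (lt_min hδ hδ')
  have key : ∀ k ≤ Δ.r, ∃ (u : ℝ → P) (v : ℝ → Q) (x : ℝ → Euc n), Measurable u ∧ Measurable v ∧
      (∀ j < k, ∀ s ∈ Ico (Δ.pts j : ℝ) (Δ.pts (j + 1)),
        u s = U.control (Δ.pts j) (x (Δ.pts j)) (U.guide Δ x₀ x j) ∧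
        v s = V.control (Δ.pts j) (x (Δ.pts j)) (V.guide Δ x₀ x j)) ∧
      Γ.IsSolution t₀ (Δ.pts k) t₀ x₀ u v x := by
    intro k
    induction k with
    | zero =>
      intro _
      obtain ⟨x, hx⟩ := H t₀ t₀ t₀.2.1 le_rfl t₀.2.2 (by simpa using hδ'.le) x₀
        (Classical.arbitrary P) (Classical.arbitrary Q)
      refine ⟨fun _ => Classical.arbitrary P, fun _ => Classical.arbitrary Q, x,
        measurable_const, measurable_const, fun j hj => by omega, ?_⟩
      rw [Δ.first]
      exact hx
    | succ k ih =>
      intro hk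
      obtain ⟨u, v, x, hu, hv, hgen, hx⟩ := ih (by omega)
      set c := Δ.pts k with hc
      have hcb : c ≤ Δ.pts (k + 1) := (Δ.increasing k hk).le
      obtain ⟨z, hz⟩ := H c (Δ.pts (k + 1)) c.2.1 hcb (Δ.pts (k + 1)).2.2
        ((hΔ k hk).trans (min_le_right _ _)) (x c) (U.control c (x c) (U.guide Δ x₀ x k))
        (V.control c (x c) (V.guide Δ x₀ x k))
      refine ⟨_, _, _, hu.ite measurableSet_Iio measurable_const,
        hv.ite measurableSet_Iio measurable_const, fun j hj s hs => ?_,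
        hx.glue hz (Δ.first_le_pts (by omega)) hcb⟩
      have hxj : ∀ i ≤ k, (if ((Δ.pts i : ℝ)) ≤ c then x (Δ.pts i) else z (Δ.pts i)) =
          x (Δ.pts i) := fun i hi => if_pos (Δ.pts_le_pts hi (by omega))
      rw [hxj j (by omega),
        U.guide_congr Δ x₀ (x := fun s => if s ≤ (c : ℝ) then x s else z s) (x' := x)
          fun i hi => hxj i (by omega),
        V.guide_congr Δ x₀ (x := fun s => if s ≤ (c : ℝ) then x s else z s) (x' := x)
          fun i hi => hxj i (by omega)]
      rcases (Nat.lt_succ_iff.1 hj).eq_or_lt with rfl | hjk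
      · exact ⟨if_neg hs.1.not_gt, if_neg hs.1.not_gt⟩
      · have hsc : s < c := hs.2.trans_le (Δ.pts_le_pts (Nat.succ_le_of_lt hjk) (by omega))
        rw [if_pos hsc, if_pos hsc]
        exact hgen j hjk s hs
  obtain ⟨u, v, x, hu, hv, hgen, hx⟩ := key Δ.r le_rfl
  rw [Δ.last] at hx
  exact ⟨Δ, x, fun k hk => (hΔ k hk).trans (min_le_left _ _), u, v, hu.aemeasurable,
    hv.aemeasurable, fun k hk s hs => (hgen k hk s hs).1, fun k hk s hs => (hgen k hk s hs).2, hx⟩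

end DiffGame

/-! ### Limits of payoffs and extremal controls -/

/-- Nonemptiness is essential: without it the infimum would be `⊤`. -/
lemma EReal.tendsto_sInf_of_approx {F : ℝ → Set EReal} {j : ℝ}
    (h : ∀ ε > 0, ∃ δ₀ > 0, ∀ δ, 0 < δ → δ ≤ δ₀ →
      (F δ).Nonempty ∧ ∀ c ∈ F δ, ∃ y : ℝ, c = y ∧ |y - j| ≤ ε) :
    Tendsto (fun δ => sInf (F δ)) (𝓝[>] 0) (𝓝 (j : EReal)) := by
  have ev : ∀ ε > 0, ∀ᶠ δ in 𝓝[>] (0 : ℝ), ((j - ε : ℝ) : EReal) ≤ sInf (F δ) ∧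
      sInf (F δ) ≤ ((j + ε : ℝ) : EReal) := by
    intro ε hε
    obtain ⟨δ₀, hδ₀, H⟩ := h ε hε
    filter_upwards [Ioc_mem_nhdsGT hδ₀] with δ hδ
    obtain ⟨⟨c, hc⟩, hF⟩ := H δ hδ.1 hδ.2
    refine ⟨le_sInf fun c hc => ?_, (sInf_le hc).trans ?_⟩
    · obtain ⟨y, rfl, hy⟩ := hF c hc
      exact EReal.coe_le_coe_iff.2 (by linarith [(abs_le.1 hy).1])
    · obtain ⟨y, rfl, hy⟩ := hF c hc
      exact EReal.coe_le_coe_iff.2 (by linarith [(abs_le.1 hy).2])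
  refine tendsto_order.2 ⟨fun a ha => ?_, fun a ha => ?_⟩
  · obtain ⟨q, haq, hq⟩ := EReal.lt_iff_exists_real_btwn.1 ha
    rw [EReal.coe_lt_coe_iff] at hq
    filter_upwards [ev (j - q) (_root_.sub_pos.2 hq)] with δ hδ
    exact haq.trans_le (by simpa using hδ.1)
  · obtain ⟨q, hq, haq⟩ := EReal.lt_iff_exists_real_btwn.1 ha
    rw [EReal.coe_lt_coe_iff] at hq
    filter_upwards [ev (q - j) (_root_.sub_pos.2 hq)] with δ hδ
    refine lt_of_le_of_lt ?_ haq
    have := hδ.2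
    rwa [add_sub_cancel] at this

/-- Monotonicity in `δ` alone gives the one-sided limit, as an infimum over positive `δ`; a single
good `δ` for each `ε` then bounds it. -/
lemma EReal.exists_tendsto_sSup_le {F : ℝ → Set EReal} {j : ℝ} (hF : Monotone F)
    (h : ∀ ε > 0, ∃ δ > 0, ∀ c ∈ F δ, c ≤ ((j + ε : ℝ) : EReal)) :
    ∃ a : EReal, Tendsto (fun δ => sSup (F δ)) (𝓝[>] 0) (𝓝 a) ∧ a ≤ j := by
  have hm : Monotone fun δ => sSup (F δ) := fun δ δ' hd => sSup_le_sSup (hF hd)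
  refine ⟨_, hm.tendsto_nhdsGT 0, EReal.le_of_forall_lt_iff_le.1 fun q hq => ?_⟩
  rw [EReal.coe_lt_coe_iff] at hq
  obtain ⟨δ, hδ, H⟩ := h (q - j) (_root_.sub_pos.2 hq)
  refine (sInf_le (mem_image_of_mem _ hδ)).trans (sSup_le fun c hc => ?_)
  simpa using H c hc

lemma TimePartition.MeshLE.mono {T : ℝ} {t₀ : TimeInt T} {Δ : TimePartition T t₀} {δ δ' : ℝ}
    (h : Δ.MeshLE δ) (hd : δ ≤ δ') : Δ.MeshLE δ' := fun k hk => (h k hk).trans hd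

/-- Controls that minimize the component of a control term in a given direction, and so maximize
it in the opposite direction. -/
lemma AdmissibleDynamics.exists_minimizer {n : ℕ} {A : Type*} [TopologicalSpace A]
    [CompactSpace A] [Nonempty A] {T : ℝ} {h : ℝ → Euc n → A → Euc n}
    (hh : AdmissibleDynamics T h) :
    ∃ c : ℝ → Euc n → Euc n → A, ∀ t ∈ Icc 0 T, ∀ ξ s,
      (∀ a, inner ℝ s (h t ξ (c t ξ s)) ≤ inner ℝ s (h t ξ a)) ∧
      ∀ a, inner ℝ s (h t ξ a) ≤ inner ℝ s (h t ξ (c t ξ (-s))) := by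
  have key : ∀ (t : ℝ) (ξ s : Euc n), ∃ c : A, t ∈ Icc 0 T → ∀ a,
      inner ℝ s (h t ξ c) ≤ inner ℝ s (h t ξ a) := by
    intro t ξ s
    by_cases ht : t ∈ Icc 0 T
    · have hc : Continuous fun a => inner ℝ s (h t ξ a) := by
        refine continuous_const.inner (continuousOn_univ.1 ?_)
        exact hh.cont.comp (f := fun a : A => (t, ξ, a)) (by fun_prop)
          fun a _ => ⟨ht, mem_univ _⟩
      obtain ⟨c, -, hc⟩ := isCompact_univ.exists_isMinOn univ_nonempty hc.continuousOn
      exact ⟨c, fun _ a => hc (mem_univ a)⟩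
    · exact ⟨Classical.arbitrary A, fun h => absurd h ht⟩
  choose c hc using key
  refine ⟨c, fun t ht ξ s => ⟨hc t ξ s ht, fun a => ?_⟩⟩
  simpa using hc t ξ (-s) ht a

/-- Near each other on a bounded set, a continuous function takes nearby values. -/
lemma exists_abs_sub_le_of_norm_sq_le {n : ℕ} {σ : Euc n → ℝ} (hσ : Continuous σ) (R : ℝ) {ε : ℝ}
    (hε : 0 < ε) :
    ∃ η > 0, ∀ x w : Euc n, ‖x‖ ≤ R → ‖w‖ ≤ R → ‖x - w‖ ^ 2 ≤ η → |σ x - σ w| ≤ ε := by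
  have hu := (isCompact_closedBall (0 : Euc n) R).uniformContinuousOn_of_continuous
    hσ.continuousOn
  obtain ⟨δ, hδ, H⟩ := Metric.uniformContinuousOn_iff.1 hu ε hε
  refine ⟨(δ / 2) ^ 2, by positivity, fun x w hx hw hxw => ?_⟩
  have : ‖x - w‖ ≤ δ / 2 := by
    exact le_of_sq_le_sq hxw (by positivity)
  have := H x (by simpa using hx) w (by simpa using hw) (by rw [dist_eq_norm]; linarith)
  rw [Real.dist_eq] at this
  exact this.le

/-! ### Outcomes, strategies and the two plans -/

namespace DiffGame

variable {n : ℕ} {P Q : Type*} {Γ : DiffGame n P Q}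

namespace Plan

variable {S : TimeInt Γ.T × Euc n → Set (ℝ × ℝ)} {π π' : ℝ × ℝ → ℝ}

/-- The terminal payoffs along a motion with controls in `A` are close to payoffs which are, for
`π`, at most the promised ones, and equal to the promised ones if no deviation was observed. -/
theorem outcome [MetricSpace P] [CompactSpace P] [MetricSpace Q] [CompactSpace Q]
    (p : Γ.Plan S π) (hf : AdmissibleDynamics Γ.T Γ.f) (hg : AdmissibleDynamics Γ.T Γ.g)
    (hσ₁ : Continuous Γ.σ₁) (hσ₂ : Continuous Γ.σ₂)
    (hS1 : ∀ (t : TimeInt Γ.T) (x : Euc n), (t : ℝ) = Γ.T → S (t, x) = {(Γ.σ₁ x, Γ.σ₂ x)})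
    (t₀ : TimeInt Γ.T) (x₀ : Euc n) {J₀ : ℝ × ℝ} (hJ₀ : J₀ ∈ S (t₀, x₀)) {ε : ℝ} (hε : 0 < ε) :
    ∃ δ > 0, ∀ Δ : TimePartition Γ.T t₀, Δ.MeshLE δ →
      ∀ (u : ℝ → P) (v : ℝ → Q) (x : ℝ → Euc n), Γ.IsSolution t₀ Γ.T t₀ x₀ u v x →
      (∀ k < Δ.r, ∀ s ∈ Ico (Δ.pts k : ℝ) (Δ.pts (k + 1)),
        (u s, v s) ∈ p.A (Δ.pts k) (x (Δ.pts k)) (p.seq Δ x₀ J₀ x k).guide) →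
      ∃ w, π (Γ.σ₁ w, Γ.σ₂ w) ≤ π J₀ ∧
        (p.OnTrack (p.seq Δ x₀ J₀ x Δ.r) Γ.T (x Γ.T) → (Γ.σ₁ w, Γ.σ₂ w) = J₀) ∧
        |Γ.σ₁ (x Γ.T) - Γ.σ₁ w| ≤ ε ∧ |Γ.σ₂ (x Γ.T) - Γ.σ₂ w| ≤ ε := by
  obtain ⟨R, H⟩ := p.tracking hf hg t₀ x₀ hJ₀
  obtain ⟨η₁, hη₁, H₁⟩ := exists_abs_sub_le_of_norm_sq_le hσ₁ R hε
  obtain ⟨η₂, hη₂, H₂⟩ := exists_abs_sub_le_of_norm_sq_le hσ₂ R hε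
  obtain ⟨δ, hδ, H⟩ := H (min η₁ η₂) (lt_min hη₁ hη₂)
  refine ⟨δ, hδ, fun Δ hΔ u v x hx hA => ?_⟩
  obtain ⟨hxR, hwR, hJ, hπ, hon, hd⟩ := H Δ hΔ u v x hx hA
  -- The witness is the final model position, where the promised pair must be the terminal payoffs.
  rw [hS1 _ _ Δ.last, mem_singleton_iff] at hJ
  rw [hJ] at hπ hon
  exact ⟨_, hπ, hon, H₁ _ _ hxR hwR (hd.trans (min_le_left _ _)),
    H₂ _ _ hxR hwR (hd.trans (min_le_right _ _))⟩

/-- If both players follow plans with the same rules for regular play, then no deviation is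
observed, and both guides coincide. -/
lemma seq_eq_and_onTrack (p : Γ.Plan S π) (p' : Γ.Plan S π') (huc : p.uc = p'.uc)
    (hvc : p.vc = p'.vc) (hnext : p.nextC = p'.nextC) {t₀ : TimeInt Γ.T} {x₀ : Euc n}
    (J₀ : ℝ × ℝ) (Δ : TimePartition Γ.T t₀) {u : ℝ → P} {v : ℝ → Q} {x : ℝ → Euc n}
    (hx : Γ.IsSolution t₀ Γ.T t₀ x₀ u v x)
    (hu : ∀ k < Δ.r, ∀ s ∈ Ico (Δ.pts k : ℝ) (Δ.pts (k + 1)),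
      u s = p.uc (Δ.pts k) (x (Δ.pts k)) (p.seq Δ x₀ J₀ x k).guide)
    (hv : ∀ k < Δ.r, ∀ s ∈ Ico (Δ.pts k : ℝ) (Δ.pts (k + 1)),
      v s = p.vc (Δ.pts k) (x (Δ.pts k)) (p'.seq Δ x₀ J₀ x k).guide) :
    ∀ k ≤ Δ.r, p.seq Δ x₀ J₀ x k = p'.seq Δ x₀ J₀ x k ∧
      p.OnTrack (p.seq Δ x₀ J₀ x k) (Δ.pts k) (x (Δ.pts k)) := by
  have ht₀I : (t₀ : ℝ) ∈ Icc (t₀ : ℝ) Γ.T := ⟨le_rfl, t₀.2.2⟩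
  have hxt₀ : x t₀ = x₀ := by simpa using hx.2.2 t₀ ht₀I
  have hiff : ∀ z t y, p.OnTrack z t y ↔ p'.OnTrack z t y := fun z t y => by
    rw [OnTrack, OnTrack, huc, hvc]
  intro k
  induction k with
  | zero =>
    -- The initial record names the initial position as its own predecessor, so the first test runs
    -- over an empty interval and any controls pass it.
    refine fun _ => ⟨rfl, trivial, u, v, x, ?_, ?_, rfl⟩
    · have := hx.restrict ht₀I le_rfl le_rfl t₀.2.2
      rw [hxt₀] at this
      rw [Δ.first]
      exact this
    · intro s hs
      rw [Δ.first] at hs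
      exact absurd hs.2 hs.1.not_gt
  | succ k ih =>
    intro hk
    obtain ⟨heq, hon⟩ := ih (by omega)
    have h1 : p.seq Δ x₀ J₀ x (k + 1) =
        p.step (Δ.pts (k + 1)) (Δ.pts k) (x (Δ.pts k)) (p.seq Δ x₀ J₀ x k) := rfl
    have h2 : p'.seq Δ x₀ J₀ x (k + 1) =
        p'.step (Δ.pts (k + 1)) (Δ.pts k) (x (Δ.pts k)) (p'.seq Δ x₀ J₀ x k) := rfl
    rw [h1, h2, ← heq, step, step, if_pos hon, if_pos ((hiff _ _ _).1 hon), hnext]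
    refine ⟨rfl, trivial, u, v, x, hx.restrict ht₀I (Δ.first_le_pts (by omega))
      (Δ.increasing k hk).le (Δ.pts (k + 1)).2.2, fun s hs => ⟨hu k hk s hs, ?_⟩, rfl⟩
    rw [hv k hk s hs, ← heq]

/-- The strategy of player I. -/
noncomputable def strategy₁ (p : Γ.Plan S π) (e : GuideState n → Euc 1) (d : Euc 1 → GuideState n)
    (J : TimeInt Γ.T × Euc n → ℝ × ℝ) : GuideStrategy Γ.T n P :=
  .ofMemory e d (fun t x z => p.uc t x z.guide) p.step fun t x => ⟨True, t, x, x, x, J (t, x)⟩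

/-- The strategy of player II. -/
noncomputable def strategy₂ (p : Γ.Plan S π) (e : GuideState n → Euc 1) (d : Euc 1 → GuideState n)
    (J : TimeInt Γ.T × Euc n → ℝ × ℝ) : GuideStrategy Γ.T n Q :=
  .ofMemory e d (fun t x z => p.vc t x z.guide) p.step fun t x => ⟨True, t, x, x, x, J (t, x)⟩

variable {e : GuideState n → Euc 1} {d : Euc 1 → GuideState n} {J : TimeInt Γ.T × Euc n → ℝ × ℝ}

lemma eq_of_generates₁ (p : Γ.Plan S π) (hde : ∀ z, d (e z) = z) {t₀ : TimeInt Γ.T} {x₀ : Euc n}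
    {Δ : TimePartition Γ.T t₀} {x : ℝ → Euc n} {u : ℝ → P}
    (h : (p.strategy₁ e d J).Generates Δ x₀ x u) :
    ∀ k < Δ.r, ∀ s ∈ Ico (Δ.pts k : ℝ) (Δ.pts (k + 1)),
      u s = p.uc (Δ.pts k) (x (Δ.pts k)) (p.seq Δ x₀ (J (t₀, x₀)) x k).guide := by
  intro k hk s hs
  rw [h k hk s hs, seq, ← GuideStrategy.guide_ofMemory hde (fun t x z => p.uc t x z.guide) p.step
    fun t x => ⟨True, t, x, x, x, J (t, x)⟩]
  rfl

lemma eq_of_generates₂ (p : Γ.Plan S π) (hde : ∀ z, d (e z) = z) {t₀ : TimeInt Γ.T} {x₀ : Euc n}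
    {Δ : TimePartition Γ.T t₀} {x : ℝ → Euc n} {v : ℝ → Q}
    (h : (p.strategy₂ e d J).Generates Δ x₀ x v) :
    ∀ k < Δ.r, ∀ s ∈ Ico (Δ.pts k : ℝ) (Δ.pts (k + 1)),
      v s = p.vc (Δ.pts k) (x (Δ.pts k)) (p.seq Δ x₀ (J (t₀, x₀)) x k).guide := by
  intro k hk s hs
  rw [h k hk s hs, seq, ← GuideStrategy.guide_ofMemory hde (fun t x z => p.vc t x z.guide) p.step
    fun t x => ⟨True, t, x, x, x, J (t, x)⟩]
  rfl

end Plan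

/-- Plans of the two players with the same rules for regular play; while the other player deviates,
player I keeps the second payoff, and player II the first payoff, from increasing. -/
lemma exists_plans [MetricSpace P] [CompactSpace P] [Nonempty P] [MeasurableSpace P]
    [MetricSpace Q] [CompactSpace Q] [Nonempty Q] [MeasurableSpace Q]
    (hf : AdmissibleDynamics Γ.T Γ.f) (hg : AdmissibleDynamics Γ.T Γ.g)
    (S : TimeInt Γ.T × Euc n → Set (ℝ × ℝ))
    (hS2 : ∀ (t : TimeInt Γ.T) (x : Euc n), ∀ J ∈ S (t, x), ∀ (u : P) (t' : TimeInt Γ.T), t ≤ t' →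
      ∃ y ∈ Γ.Sol₂ t x u, ∃ J' ∈ S (t', y t'), J'.1 ≤ J.1)
    (hS3 : ∀ (t : TimeInt Γ.T) (x : Euc n), ∀ J ∈ S (t, x), ∀ (v : Q) (t' : TimeInt Γ.T), t ≤ t' →
      ∃ y ∈ Γ.Sol₁ t x v, ∃ J'' ∈ S (t', y t'), J''.2 ≤ J.2)
    (hS4 : ∀ (t : TimeInt Γ.T) (x : Euc n), ∀ J ∈ S (t, x), ∀ t' : TimeInt Γ.T, t ≤ t' →
      ∃ y ∈ Γ.Sol t x, J ∈ S (t', y t')) :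
    ∃ (p₁ : Γ.Plan S Prod.snd) (p₂ : Γ.Plan S Prod.fst), p₁.uc = p₂.uc ∧ p₁.vc = p₂.vc ∧
      p₁.nextC = p₂.nextC ∧ (∀ t x w, p₁.A t x w = {c | c.1 = p₁.uc t x w}) ∧
      ∀ t x w, p₂.A t x w = {c | c.2 = p₂.vc t x w} := by
  obtain ⟨mf, hmf⟩ := hf.exists_minimizer
  obtain ⟨mg, hmg⟩ := hg.exists_minimizer
  -- The hypotheses are put inside the existential, here and in the next two claims, so that choice
  -- yields total functions; the value `0` is a dummy.
  have next₄ : ∀ (a b : TimeInt Γ.T) (ω : Euc n) (J : ℝ × ℝ), ∃ w : Euc n, a ≤ b → J ∈ S (a, ω) →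
      J ∈ S (b, w) ∧ ∃ y ∈ Γ.Sol a ω, y b = w := by
    intro a b ω J
    by_cases h : a ≤ b ∧ J ∈ S (a, ω)
    · obtain ⟨y, hy, hJ⟩ := hS4 a ω J h.2 b h.1
      exact ⟨y b, fun _ _ => ⟨hJ, y, hy, rfl⟩⟩
    · exact ⟨0, fun h₁ h₂ => absurd ⟨h₁, h₂⟩ h⟩
  have next₃ : ∀ (a b : TimeInt Γ.T) (ω : Euc n) (J : ℝ × ℝ) (q : Q), ∃ w : Euc n × (ℝ × ℝ),
      a ≤ b → J ∈ S (a, ω) → w.2 ∈ S (b, w.1) ∧ w.2.2 ≤ J.2 ∧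
      ∃ y ∈ Γ.Sol₁ a ω q, y b = w.1 := by
    intro a b ω J q
    by_cases h : a ≤ b ∧ J ∈ S (a, ω)
    · obtain ⟨y, hy, J', hJ', hle⟩ := hS3 a ω J h.2 q b h.1
      exact ⟨(y b, J'), fun _ _ => ⟨hJ', hle, y, hy, rfl⟩⟩
    · exact ⟨0, fun h₁ h₂ => absurd ⟨h₁, h₂⟩ h⟩
  have next₂ : ∀ (a b : TimeInt Γ.T) (ω : Euc n) (J : ℝ × ℝ) (q : P), ∃ w : Euc n × (ℝ × ℝ),
      a ≤ b → J ∈ S (a, ω) → w.2 ∈ S (b, w.1) ∧ w.2.1 ≤ J.1 ∧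
      ∃ y ∈ Γ.Sol₂ a ω q, y b = w.1 := by
    intro a b ω J q
    by_cases h : a ≤ b ∧ J ∈ S (a, ω)
    · obtain ⟨y, hy, J', hJ', hle⟩ := hS2 a ω J h.2 q b h.1
      exact ⟨(y b, J'), fun _ _ => ⟨hJ', hle, y, hy, rfl⟩⟩
    · exact ⟨0, fun h₁ h₂ => absurd ⟨h₁, h₂⟩ h⟩
  choose n₄ hn₄ using next₄
  choose n₃ hn₃ using next₃
  choose n₂ hn₂ using next₂
  set uc : ℝ → Euc n → Euc n → P := fun t ξ ω => mf t ξ (ξ - ω)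
  set vc : ℝ → Euc n → Euc n → Q := fun t ξ ω => mg t ξ (ξ - ω)
  have hC : ∀ a b : TimeInt Γ.T, a ≤ b → ∀ ξ ω, ∀ J ∈ S (a, ω), J ∈ S (b, n₄ a b ω J) ∧
      ∃ y ∈ Γ.Aim {(uc a ξ ω, vc a ξ ω)} a ξ ω, y b = n₄ a b ω J := by
    intro a b hab ξ ω J hJ
    obtain ⟨h, y, hy, hyb⟩ := hn₄ a b ω J hab hJ
    refine ⟨h, y, closure_mono ?_ hy, hyb⟩
    rintro y ⟨u, v, -, -, hm⟩
    refine ⟨u, v, hm, fun s c hc => ?_⟩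
    rw [mem_singleton_iff] at hc
    rw [hc]
    exact ⟨(hmf a a.2 ξ (ξ - ω)).1 _, (hmg a a.2 ξ (ξ - ω)).1 _⟩
  -- The deviator's model control is the minimizer for `-(ξ - ω)`, hence the maximizer for `ξ - ω`.
  -- The player's own model control may be arbitrary, because the real one is already the minimizer.
  refine ⟨⟨uc, vc, fun t x w => {c | c.1 = uc t x w}, n₄,
      fun a b ξ ω J => n₃ a b ω J (mg a ξ (-(ξ - ω))), hC, fun a b hab ξ ω J hJ => ?_⟩,
    ⟨uc, vc, fun t x w => {c | c.2 = vc t x w}, n₄,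
      fun a b ξ ω J => n₂ a b ω J (mf a ξ (-(ξ - ω))), hC, fun a b hab ξ ω J hJ => ?_⟩,
    rfl, rfl, rfl, fun _ _ _ => rfl, fun _ _ _ => rfl⟩
  · obtain ⟨h, hle, y, hy, hyb⟩ := hn₃ a b ω J (mg a ξ (-(ξ - ω))) hab hJ
    refine ⟨h, hle, y, closure_mono ?_ hy, hyb⟩
    rintro y ⟨u, -, hm⟩
    refine ⟨u, _, hm, fun s c (hc : c.1 = _) => ?_⟩
    rw [hc]
    exact ⟨(hmf a a.2 ξ (ξ - ω)).1 _, (hmg a a.2 ξ (ξ - ω)).2 _⟩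
  · obtain ⟨h, hle, y, hy, hyb⟩ := hn₂ a b ω J (mf a ξ (-(ξ - ω))) hab hJ
    refine ⟨h, hle, y, closure_mono ?_ hy, hyb⟩
    rintro y ⟨v, -, hm⟩
    refine ⟨_, v, hm, fun s c (hc : c.2 = _) => ?_⟩
    rw [hc]
    exact ⟨(hmf a a.2 ξ (ξ - ω)).2 _, (hmg a a.2 ξ (ξ - ω)).1 _⟩

end DiffGame

/-! ### The equilibrium -/

theorem mainTheorem1 {n : ℕ} {P Q : Type*}
    [MetricSpace P] [CompactSpace P] [Nonempty P] [MeasurableSpace P] [BorelSpace P]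
    [MetricSpace Q] [CompactSpace Q] [Nonempty Q] [MeasurableSpace Q] [BorelSpace Q]
    (Γ : DiffGame n P Q) (_hT : 0 ≤ Γ.T)
    (_hf : AdmissibleDynamics Γ.T Γ.f) (_hg : AdmissibleDynamics Γ.T Γ.g)
    (_hσ₁ : Continuous Γ.σ₁) (_hσ₂ : Continuous Γ.σ₂)
    (S : TimeInt Γ.T × Euc n → Set (ℝ × ℝ))
    (_hS : UpperHemicontinuous S) (_hne : ∀ p, (S p).Nonempty)
    (_S1 : ∀ (t : TimeInt Γ.T) (x : Euc n), (t : ℝ) = Γ.T → S (t, x) = {(Γ.σ₁ x, Γ.σ₂ x)})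
    (_S2 : ∀ (t : TimeInt Γ.T) (x : Euc n), ∀ J ∈ S (t, x), ∀ (u : P) (t' : TimeInt Γ.T), t ≤ t' →
      ∃ y ∈ Γ.Sol₂ t x u, ∃ J' ∈ S (t', y t'), J'.1 ≤ J.1)
    (_S3 : ∀ (t : TimeInt Γ.T) (x : Euc n), ∀ J ∈ S (t, x), ∀ (v : Q) (t' : TimeInt Γ.T), t ≤ t' →
      ∃ y ∈ Γ.Sol₁ t x v, ∃ J'' ∈ S (t', y t'), J''.2 ≤ J.2)
    (_S4 : ∀ (t : TimeInt Γ.T) (x : Euc n), ∀ J ∈ S (t, x), ∀ t' : TimeInt Γ.T, t ≤ t' →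
      ∃ y ∈ Γ.Sol t x, J ∈ S (t', y t'))
    (J : TimeInt Γ.T × Euc n → ℝ × ℝ) (_hJ : ∀ p, J p ∈ S p)
    (G : Set (TimeInt Γ.T × Euc n)) (_hG : IsCompact G) :
    ∃ (U : GuideStrategy Γ.T n P) (V : GuideStrategy Γ.T n Q),
      Γ.IsNash U V G ∧ ∀ p ∈ G, Γ.HasPayoff U V p (J p) := by
  obtain ⟨p₁, p₂, huc, hvc, hnext, hA₁, hA₂⟩ := DiffGame.exists_plans _hf _hg S _S2 _S3 _S4
  obtain ⟨e, he⟩ := GuideState.exists_injective n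
  have : Nonempty (GuideState n) := ⟨⟨True, 0, 0, 0, 0, 0⟩⟩
  obtain ⟨d, hde⟩ := he.hasLeftInverse
  have out₁ := fun t₀ x₀ (ε : ℝ) (hε : 0 < ε) =>
    p₁.outcome _hf _hg _hσ₁ _hσ₂ _S1 t₀ x₀ (_hJ (t₀, x₀)) hε
  have out₂ := fun t₀ x₀ (ε : ℝ) (hε : 0 < ε) =>
    p₂.outcome _hf _hg _hσ₁ _hσ₂ _S1 t₀ x₀ (_hJ (t₀, x₀)) hε
  set U := p₁.strategy₁ e d J
  set V := p₂.strategy₂ e d J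
  have joint : ∀ t₀ x₀, ∀ ε > 0, ∃ δ₀ > 0, ∀ (Δ : TimePartition Γ.T t₀) (x : ℝ → Euc n),
      Δ.MeshLE δ₀ → Γ.IsStepMotionC t₀ x₀ U V Δ x →
      |Γ.σ₁ (x Γ.T) - (J (t₀, x₀)).1| ≤ ε ∧ |Γ.σ₂ (x Γ.T) - (J (t₀, x₀)).2| ≤ ε := by
    intro t₀ x₀ ε hε
    obtain ⟨δ, hδ, H⟩ := out₁ t₀ x₀ ε hε
    refine ⟨δ, hδ, fun Δ x hΔ ⟨u, v, _, _, hu, hv, hx⟩ => ?_⟩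
    have hu' := p₁.eq_of_generates₁ hde hu
    have hv' := p₂.eq_of_generates₂ hde hv
    -- Under joint play the plan of player I alone determines both payoffs: being on track up to `T`
    -- forces the promised pair to be the initial one.
    obtain ⟨w, -, hon, h₁, h₂⟩ := H Δ hΔ u v x hx fun k hk s hs => by
      rw [hA₁]; exact hu' k hk s hs
    have htrack := (p₁.seq_eq_and_onTrack p₂ huc hvc hnext (J (t₀, x₀)) Δ hx hu'
      (by rwa [hvc]) Δ.r le_rfl).2
    rw [Δ.last] at htrack
    rw [← hon htrack]
    exact ⟨h₁, h₂⟩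
  have pay₁ : ∀ t₀ x₀, Tendsto (Γ.jointInf Γ.σ₁ U V t₀ x₀) (𝓝[>] 0)
      (𝓝 ((J (t₀, x₀)).1 : EReal)) := fun t₀ x₀ =>
    EReal.tendsto_sInf_of_approx fun ε hε => by
      obtain ⟨δ₀, hδ₀, H⟩ := joint t₀ x₀ ε hε
      refine ⟨δ₀, hδ₀, fun δ hδ hδδ => ⟨?_, ?_⟩⟩
      · obtain ⟨Δ, x, hΔ, hx⟩ := DiffGame.exists_stepMotionC _hf _hg U V t₀ x₀ hδ
        exact ⟨_, Δ, x, hΔ, hx, rfl⟩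
      · rintro c ⟨Δ, x, hΔ, hx, rfl⟩
        exact ⟨_, rfl, (H Δ x (hΔ.mono hδδ) hx).1⟩
  have pay₂ : ∀ t₀ x₀, Tendsto (Γ.jointInf Γ.σ₂ U V t₀ x₀) (𝓝[>] 0)
      (𝓝 ((J (t₀, x₀)).2 : EReal)) := fun t₀ x₀ =>
    EReal.tendsto_sInf_of_approx fun ε hε => by
      obtain ⟨δ₀, hδ₀, H⟩ := joint t₀ x₀ ε hε
      refine ⟨δ₀, hδ₀, fun δ hδ hδδ => ⟨?_, ?_⟩⟩
      · obtain ⟨Δ, x, hΔ, hx⟩ := DiffGame.exists_stepMotionC _hf _hg U V t₀ x₀ hδ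
        exact ⟨_, Δ, x, hΔ, hx, rfl⟩
      · rintro c ⟨Δ, x, hΔ, hx, rfl⟩
        exact ⟨_, rfl, (H Δ x (hΔ.mono hδδ) hx).2⟩
  refine ⟨U, V, fun p _ => ⟨?_, ?_⟩, fun p _ => ⟨pay₁ p.1 p.2, pay₂ p.1 p.2⟩⟩
  · obtain ⟨a, ha, haJ⟩ : ∃ a : EReal, Tendsto (Γ.devSup₁ V p.1 p.2) (𝓝[>] 0) (𝓝 a) ∧
        a ≤ ((J (p.1, p.2)).1 : EReal) := by
      refine EReal.exists_tendsto_sSup_le ?_ fun ε hε => ?_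
      · rintro δ δ' hd c ⟨Δ, u, x, hΔ, h⟩
        exact ⟨Δ, u, x, hΔ.mono hd, h⟩
      · obtain ⟨δ, hδ, H⟩ := out₂ p.1 p.2 ε hε
        refine ⟨δ, hδ, ?_⟩
        rintro c ⟨Δ, u, x, hΔ, _, ⟨v, _, hv, hx⟩, rfl⟩
        -- Only the control of player II is known here, which is all that membership in `p₂.A` asks;
        -- `hw` then bounds the first payoff at the model position.
        obtain ⟨w, hw, -, h₁, -⟩ := H Δ hΔ u v x hx fun k hk s hs => by
          rw [hA₂]; exact p₂.eq_of_generates₂ hde hv k hk s hs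
        exact EReal.coe_le_coe_iff.2 (by simp only at hw; linarith [(abs_le.1 h₁).2])
    exact ⟨a, _, ha, pay₁ p.1 p.2, haJ⟩
  · obtain ⟨a, ha, haJ⟩ : ∃ a : EReal, Tendsto (Γ.devSup₂ U p.1 p.2) (𝓝[>] 0) (𝓝 a) ∧
        a ≤ ((J (p.1, p.2)).2 : EReal) := by
      refine EReal.exists_tendsto_sSup_le ?_ fun ε hε => ?_
      · rintro δ δ' hd c ⟨Δ, v, x, hΔ, h⟩
        exact ⟨Δ, v, x, hΔ.mono hd, h⟩
      · obtain ⟨δ, hδ, H⟩ := out₁ p.1 p.2 ε hε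
        refine ⟨δ, hδ, ?_⟩
        rintro c ⟨Δ, v, x, hΔ, _, ⟨u, _, hu, hx⟩, rfl⟩
        obtain ⟨w, hw, -, -, h₂⟩ := H Δ hΔ u v x hx fun k hk s hs => by
          rw [hA₁]; exact p₁.eq_of_generates₁ hde hu k hk s hs
        exact EReal.coe_le_coe_iff.2 (by simp only at hw; linarith [(abs_le.1 h₂).2])
    exact ⟨a, _, ha, pay₂ p.1 p.2, haJ⟩
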